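/- **Theorem (A-priori bounds on the strong solution).** Let $\Omega\subseteq\mathbb R^n$ be a bounded domain with boundary $\Sigma=\partial\Omega$ of class $\mathrm C^2$ and outer unit normal $\boldsymbol n$. Consider $N$ species with diffusion coefficients $d_i>0$, $\mathbb D=\operatorname{diag}(d_1,\dots,d_N)$, and chemical potentials $\mu_i(\boldsymbol c)=\mu_i^0+\ln c_i$ with constants $\mu_i^0\in\mathbb R$. Let $m$ reversible bulk reactions be given by $\boldsymbol\alpha^a,\boldsymbol\beta^a\in\mathbb N_0^N$, $\boldsymbol\nu^a=\boldsymbol\beta^a-\boldsymbol\alpha^a$, with rates $$\boldsymbol r(\boldsymbol c)=\sum_{a=1}^m\big(k_a^f\boldsymbol c^{\boldsymbol\alpha^a}-k_a^b\boldsymbol c^{\boldsymbol\beta^a}\big)\boldsymbol\nu^a,\qquad k_a^f,k_a^b>0,\quad \frac{k_a^f}{k_a^b}=\exp(-\boldsymbol\nu^a\cdot\boldsymbol\mu^0),$$ and let $m^\Sigma$ reversible surface reactions be given by $\boldsymbol\alpha^{\Sigma,a},\boldsymbol\beta^{\Sigma,a}\in\mathbb N_0^N$ with linearly independent stoichiometric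 vectors $\boldsymbol\nu^{\Sigma,a}=\boldsymbol\beta^{\Sigma,a}-\boldsymbol\alpha^{\Sigma,a}$; let $\boldsymbol e^1,\dots,\boldsymbol e^{n^\Sigma}$ be a basis of $\{\boldsymbol\nu^{\Sigma,a}:a=1,\dots,m^\Sigma\}^\perp$. Let $T_{\max}\in(0,\infty]$ and let $\boldsymbol c\in\mathrm C^{(1,2)}([0,T_{\max})\times\overline\Omega;(0,\infty)^N)$ (that is, $\boldsymbol c$, $\partial_t\boldsymbol c$, $\nabla\boldsymbol c$, $\nabla^2\boldsymbol c$ are continuous on $[0,T_{\max})\times\overline\Omega$) be a classical solution of $$\begin{aligned} \partial_t\boldsymbol c-\mathbb D\Delta\boldsymbol c&=\boldsymbol r(\boldsymbol c) && \text{on }[0,T_{\max})\times\Omega,\\ \boldsymbol c^{\boldsymbol\nu^{\Sigma,a}}&=\exp(-\boldsymbol\nu^{\Sigma,a}\cdot\boldsymbol\mu^0),\quad a=1,\dots,m^\Sigma, && \text{on }[0,T_{\max})\times\Sigma,\\ -\langle\boldsymbol e^k,\mathbb D\,\partial_{\boldsymbol n}\boldsymbol c\rangle&=0,\quad k=1,\dots,n^\Sigma,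 && \text{on }[0,T_{\max})\times\Sigma,\\ \boldsymbol c(0,\cdot)&=\boldsymbol c^0 && \text{on }\overline\Omega. \end{aligned}$$ Assume that there is a strictly positive conserved quantity, i.e. a vector $\boldsymbol e\in(0,\infty)^N$ orthogonal to all $\boldsymbol\nu^a$ and all $\boldsymbol\nu^{\Sigma,a}$. Then for every real $T_0\in(0,T_{\max}]$ there is a constant $C>0$, depending only on $T_0$, $\boldsymbol c^0$ and the data $\Omega,\boldsymbol e,d_i,\mu^0_i,\boldsymbol\alpha^a,\boldsymbol\beta^a,k_a^f,k_a^b,\boldsymbol\alpha^{\Sigma,a},\boldsymbol\beta^{\Sigma,a},\boldsymbol e^k$ of the problem, such that all integrals below are finite and: 1. $\displaystyle\sup_{t\in[0,T_0)}\|\boldsymbol c(t,\cdot)\|_{\mathrm L_1(\Omega)}\le\frac{\max_ie_i}{\min_ie_i}\,\|\boldsymbol c^0\|_{\mathrm L_1(\Omega)}$, where $\|\boldsymbol v\|_{\mathrm L_1(\Omega)}=\int_\Omega\sum_i|v_i|\,\mathrm d\boldsymbol z$; 2. $\displaystyle\sup_{\boldsymbol z\in\overline\Omega}\int_0^{T_0}\sum_i|c_i(t,\boldsymbol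 z)|\,\mathrm dt\le C$; 3. $\displaystyle\|\boldsymbol c\|_{\mathrm L_2([0,T_0)\times\Omega;\mathbb R^N)}\le C$; 4. for all $t\in[0,T_0)$ the entropy identity holds: $$\begin{aligned} &\int_\Omega\sum_{i=1}^Nc_i(t,\boldsymbol z)\big(\mu_i^0+\ln c_i(t,\boldsymbol z)-1\big)\,\mathrm d\boldsymbol z+\int_0^t\!\int_\Omega\sum_{i=1}^Nd_i\frac{|\nabla c_i(s,\boldsymbol z)|^2}{c_i(s,\boldsymbol z)}\,\mathrm d\boldsymbol z\,\mathrm ds\\ &\quad+\sum_{a=1}^m\int_0^t\!\int_\Omega k_a^f\,\boldsymbol c^{\boldsymbol\alpha^a}\,\big(\boldsymbol\nu^a\cdot\boldsymbol\mu(\boldsymbol c)\big)\Big(\exp\big(\boldsymbol\nu^a\cdot\boldsymbol\mu(\boldsymbol c)\big)-1\Big)\,\mathrm d\boldsymbol z\,\mathrm ds =\int_\Omega\sum_{i=1}^Nc_i^0(\boldsymbol z)\big(\mu_i^0+\ln c_i^0(\boldsymbol z)-1\big)\,\mathrm d\boldsymbol z . \end{aligned}$$ -/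

import Mathlib

open MeasureTheory Set
open scoped Gradient InnerProductSpace

noncomputable section

/-- `ρ` is a local `C²` defining function of `Ω` near the boundary point `z`: on the open
neighbourhood `U` of `z` the set `Ω` is `{ρ < 0}`, `ρ z = 0`, and `∇ρ z ≠ 0`. -/
structure IsLocalDefiningFunction {n : ℕ} (Ω : Set (EuclideanSpace ℝ (Fin n)))
    (z : EuclideanSpace ℝ (Fin n)) (U : Set (EuclideanSpace ℝ (Fin n)))
    (ρ : EuclideanSpace ℝ (Fin n) → ℝ) : Prop where
  isOpen : IsOpen U
  mem : z ∈ U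
  contDiffOn : ContDiffOn ℝ 2 ρ U
  eq_zero : ρ z = 0
  gradient_ne_zero : ∇ ρ z ≠ 0
  inter_eq : Ω ∩ U = {x | x ∈ U ∧ ρ x < 0}

/-- Bounded open subsets of `ℝⁿ` with boundary of class `C²`. -/
structure IsBoundedC2Domain {n : ℕ} (Ω : Set (EuclideanSpace ℝ (Fin n))) : Prop where
  isOpen : IsOpen Ω
  isBounded : Bornology.IsBounded Ω
  boundary : ∀ z ∈ frontier Ω, ∃ U ρ, IsLocalDefiningFunction Ω z U ρ

/-- `ν` is the outer unit normal to `Ω` at `z ∈ ∂Ω`, i.e. `∇ρ z / |∇ρ z|`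
(the value does not depend on the local defining function). -/
def IsOuterUnitNormal {n : ℕ} (Ω : Set (EuclideanSpace ℝ (Fin n)))
    (z ν : EuclideanSpace ℝ (Fin n)) : Prop :=
  ∃ U ρ, IsLocalDefiningFunction Ω z U ρ ∧ ν = ‖∇ ρ z‖⁻¹ • ∇ ρ z

/-- The half-open time interval `[0, T)`, with `T = ∞` allowed. -/
def timeInterval (T : EReal) : Set ℝ := {t | 0 ≤ t ∧ (t : EReal) < T}

/-- `u ∈ C^{(1,2)}([0,T) × closure Ω)`: the function `u`, its time derivative and its spatial
derivatives up to order two exist and are continuous on `[0,T) × closure Ω`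
(one-sided derivatives at `t = 0`, derivatives relative to `closure Ω` at boundary points). -/
structure IsC12 {n : ℕ} {F : Type*} [NormedAddCommGroup F] [NormedSpace ℝ F]
    (T : EReal) (Ω : Set (EuclideanSpace ℝ (Fin n)))
    (u : ℝ → EuclideanSpace ℝ (Fin n) → F) : Prop where
  time_differentiable : ∀ z ∈ closure Ω,
    DifferentiableOn ℝ (fun s => u s z) (timeInterval T)
  time_deriv_continuous : ContinuousOn
    (fun p : ℝ × EuclideanSpace ℝ (Fin n) =>
      derivWithin (fun s => u s p.2) (timeInterval T) p.1) (timeInterval T ×ˢ closure Ω)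
  space_contDiff : ∀ t ∈ timeInterval T, ContDiffOn ℝ 2 (u t) (closure Ω)
  space_deriv_continuous : ∀ k : ℕ, k ≤ 2 → ContinuousOn
    (fun p : ℝ × EuclideanSpace ℝ (Fin n) =>
      iteratedFDerivWithin ℝ k (u p.1) (closure Ω) p.2) (timeInterval T ×ˢ closure Ω)

/-- Data of the limit model: `N` species, `m` reversible bulk reactions, `mS` reversible surface
reactions, and `nS` conserved quantities of the surface chemistry. -/
structure CatalysisSystem (N m mS nS : ℕ) where
  /-- diffusion coefficients -/
  d : Fin N → ℝ
  d_pos : ∀ i, 0 < d i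
  /-- equilibrium parts of the chemical potentials -/
  mu0 : Fin N → ℝ
  /-- bulk stoichiometric coefficients, left-hand side and right-hand side -/
  α : Fin m → Fin N → ℕ
  β : Fin m → Fin N → ℕ
  /-- surface stoichiometric coefficients, left-hand side and right-hand side -/
  αS : Fin mS → Fin N → ℕ
  βS : Fin mS → Fin N → ℕ
  /-- forward and backward rate constants of the bulk reactions -/
  kf : Fin m → ℝ
  kb : Fin m → ℝ
  kf_pos : ∀ a, 0 < kf a
  kb_pos : ∀ a, 0 < kb a
  /-- thermodynamic consistency `kf / kb = exp (- ν · μ⁰)` -/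
  rate_relation : ∀ a, kf a / kb a =
    Real.exp (-∑ i, (((β a i : ℤ) - (α a i : ℤ) : ℤ) : ℝ) * mu0 i)
  /-- the surface stoichiometric vectors are linearly independent -/
  surface_linearIndependent : LinearIndependent ℝ (fun a : Fin mS =>
    (WithLp.toLp 2 (fun i => (((βS a i : ℤ) - (αS a i : ℤ) : ℤ) : ℝ)) : EuclideanSpace ℝ (Fin N)))
  /-- a basis of the orthogonal complement of the surface stoichiometric vectors -/
  eS : Fin nS → EuclideanSpace ℝ (Fin N)
  eS_linearIndependent : LinearIndependent ℝ eS
  eS_span : Submodule.span ℝ (range eS) = (Submodule.span ℝ (range (fun a : Fin mS =>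
    (WithLp.toLp 2 (fun i => (((βS a i : ℤ) - (αS a i : ℤ) : ℤ) : ℝ)) :
      EuclideanSpace ℝ (Fin N)))))ᗮ

namespace CatalysisSystem

variable {N m mS nS : ℕ}

/-- bulk stoichiometric vectors `ν^a = β^a - α^a` -/
def nu (S : CatalysisSystem N m mS nS) (a : Fin m) (i : Fin N) : ℤ := (S.β a i : ℤ) - (S.α a i : ℤ)

/-- surface stoichiometric vectors -/
def nuS (S : CatalysisSystem N m mS nS) (a : Fin mS) (i : Fin N) : ℤ :=
  (S.βS a i : ℤ) - (S.αS a i : ℤ)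

/-- chemical potentials `μ_i = μ_i⁰ + ln c_i` -/
def mu (S : CatalysisSystem N m mS nS) (c : EuclideanSpace ℝ (Fin N)) (i : Fin N) : ℝ :=
  S.mu0 i + Real.log (c i)

/-- reaction velocities `R_a(c) = kf_a c^{α^a} - kb_a c^{β^a}` -/
def velocity (S : CatalysisSystem N m mS nS) (c : EuclideanSpace ℝ (Fin N)) (a : Fin m) : ℝ :=
  S.kf a * ∏ i, c i ^ S.α a i - S.kb a * ∏ i, c i ^ S.β a i

/-- total molar reaction rates `r(c) = ∑ R_a(c) ν^a` -/
def rate (S : CatalysisSystem N m mS nS) (c : EuclideanSpace ℝ (Fin N)) (i : Fin N) : ℝ :=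
  ∑ a, S.velocity c a * (S.nu a i : ℝ)

/-- chemical affinities `ν^a · μ(c)` of the bulk reactions -/
def affinity (S : CatalysisSystem N m mS nS) (c : EuclideanSpace ℝ (Fin N)) (a : Fin m) : ℝ :=
  ∑ i, (S.nu a i : ℝ) * S.mu c i

/-- `c` is a (positive) classical solution on `[0, T) × closure Ω`, with initial data `c0`, of the
fast-sorption--fast-surface-chemistry--fast-transmission limit problem. -/
structure IsClassicalSolution {n : ℕ} (S : CatalysisSystem N m mS nS)
    (Ω : Set (EuclideanSpace ℝ (Fin n))) (T : EReal)
    (c0 : EuclideanSpace ℝ (Fin n) → EuclideanSpace ℝ (Fin N))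
    (c : ℝ → EuclideanSpace ℝ (Fin n) → EuclideanSpace ℝ (Fin N)) : Prop where
  regular : IsC12 T Ω c
  pos : ∀ t ∈ timeInterval T, ∀ z ∈ closure Ω, ∀ i, 0 < c t z i
  bulk : ∀ t ∈ timeInterval T, ∀ z ∈ Ω, ∀ i,
    derivWithin (fun s => c s z i) (timeInterval T) t
      - S.d i * Laplacian.laplacian (fun x => c t x i) z = S.rate (c t z) i
  surface_equilibrium : ∀ t ∈ timeInterval T, ∀ z ∈ frontier Ω, ∀ a,
    ∏ i, c t z i ^ S.nuS a i = Real.exp (-∑ i, (S.nuS a i : ℝ) * S.mu0 i)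
  no_flux : ∀ t ∈ timeInterval T, ∀ z ∈ frontier Ω, ∀ ν, IsOuterUnitNormal Ω z ν → ∀ k,
    -∑ i, S.eS k i * (S.d i * fderivWithin ℝ (fun x => c t x i) (closure Ω) z ν) = 0
  initial : ∀ z ∈ closure Ω, c 0 z = c0 z

/-- `e` has strictly positive entries and is orthogonal to all bulk and surface stoichiometric
vectors. -/
structure IsPositiveConserved (S : CatalysisSystem N m mS nS) (e : Fin N → ℝ) : Prop where
  pos : ∀ i, 0 < e i
  bulk : ∀ a, ∑ i, e i * (S.nu a i : ℝ) = 0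
  surface : ∀ a, ∑ i, e i * (S.nuS a i : ℝ) = 0

/-- entropy density `∑ c_i (μ_i⁰ + ln c_i - 1)` -/
def entropyDensity (S : CatalysisSystem N m mS nS) (c : EuclideanSpace ℝ (Fin N)) : ℝ :=
  ∑ i, c i * (S.mu0 i + Real.log (c i) - 1)

/-- dissipation density of the diffusion, `∑ d_i |∇c_i|² / c_i` at the point `z` -/
def diffusionDissipation {n : ℕ} (S : CatalysisSystem N m mS nS)
    (v : EuclideanSpace ℝ (Fin n) → EuclideanSpace ℝ (Fin N))
    (z : EuclideanSpace ℝ (Fin n)) : ℝ :=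
  ∑ i, S.d i * (‖∇ (fun x => v x i) z‖ ^ 2 / v z i)

/-- dissipation density `kf_a c^{α^a} (ν^a · μ) (exp (ν^a · μ) - 1)` of the `a`-th bulk reaction -/
def reactionDissipation (S : CatalysisSystem N m mS nS)
    (c : EuclideanSpace ℝ (Fin N)) (a : Fin m) : ℝ :=
  (S.kf a * ∏ i, c i ^ S.α a i) * (S.affinity c a * (Real.exp (S.affinity c a) - 1))

end CatalysisSystem

end

/-!
The proof rests on one form of the divergence theorem: a field `F` that is continuous on `closure
Ω`, `C¹` in `Ω` and tangent to the boundary satisfies `∫_Ω div F = 0`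
(`IsTangentialField.setIntegral_divg_eq_zero`). It needs no surface measure. In a chart `Ω = {ρ <
0}` one multiplies `F` by a cutoff of `ρ`. The gradient of the cutoff concentrates where the
normal component of `F` is small, and its total mass is bounded, as testing with a fixed
transversal field shows. A partition of unity globalizes. On the boundary, any `ξ` orthogonal to
the surface stoichiometric vectors lies in the span of the vectors `eS k`, so the `ξ`-component of
the diffusive flux vanishes (`CatalysisSystem.IsClassicalSolution.sum_flux_eq_zero`).

With `w = ∑ e_i c_i` and `a = ∑ e_i d_i c_i` the reactions cancel and `∂ₜ w = Δ a`, `∂ₙ a = 0`;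
hence `∫ w` is constant, which is the first estimate. Put `W(t) = ∫₀ᵗ a`, `D = ∑ d_i`, and let `M`
bound `w(0)`. Then `ΔW = w - w(0)` with zero Neumann data and `0 ≤ ∂ₜ W = a ≤ D w`, so `∂ₜ W ≤ D
ΔW + D M`. The comparison principle `W ≤ D M t` (`IsConservedDensity.time_primitive_le`) is the
second estimate. Multiplying `ΔW = w - w(0)` by `∂ₜ W = a` and
integrating gives `∬ w a = ∬ w(0) a - ½ ∫ |∇W|²`
(`IsConservedDensity.intervalIntegral_mul_sub_nonpos`). With `|c|² ≲ w a` and the bound for `W` this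
is the third. The estimates hold on `[0, t]` for every `t < T₀`, with constants depending on `T₀`
only, so they pass to `[0, T₀)` by monotone convergence.

The entropy identity is Green's identity with the test functions `d_i μ_i`. The boundary term
vanishes because surface equilibrium says exactly that `μ` is orthogonal to the surface
stoichiometric vectors, and the reaction term is rewritten with `kb c^β = kf c^α exp(ν · μ)`, the
thermodynamic consistency of the rate constants.
-/

noncomputable section

/-! ### The divergence theorem for fields tangent to the boundary -/

/-- The divergence `∑ₖ ∂ₖ Fₖ` of a vector field on `ℝⁿ`. -/
def divg {n : ℕ} (F : EuclideanSpace ℝ (Fin n) → EuclideanSpace ℝ (Fin n))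
    (x : EuclideanSpace ℝ (Fin n)) : ℝ :=
  ∑ k, fderiv ℝ F x (EuclideanSpace.single k 1) k

section Divergence

open Filter Topology

variable {n : ℕ}

lemma divg_congr {F G : EuclideanSpace ℝ (Fin n) → EuclideanSpace ℝ (Fin n)}
    {x : EuclideanSpace ℝ (Fin n)} (h : F =ᶠ[𝓝 x] G) : divg F x = divg G x := by
  simp only [divg, h.fderiv_eq]

lemma divg_eq_zero_of_eventually {F : EuclideanSpace ℝ (Fin n) → EuclideanSpace ℝ (Fin n)}
    {x : EuclideanSpace ℝ (Fin n)} (h : F =ᶠ[𝓝 x] fun _ => 0) : divg F x = 0 := by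
  rw [divg_congr h]
  simp [divg]

lemma sum_smul_single (v : EuclideanSpace ℝ (Fin n)) :
    ∑ k, v k • EuclideanSpace.single k (1 : ℝ) = v := by
  ext j
  simp [Finset.sum_apply, Pi.single_apply]

lemma divg_smul {φ : EuclideanSpace ℝ (Fin n) → ℝ}
    {F : EuclideanSpace ℝ (Fin n) → EuclideanSpace ℝ (Fin n)} {x : EuclideanSpace ℝ (Fin n)}
    (hφ : DifferentiableAt ℝ φ x) (hF : DifferentiableAt ℝ F x) :
    divg (fun y => φ y • F y) x = φ x * divg F x + fderiv ℝ φ x (F x) := by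
  have h : fderiv ℝ φ x (F x) = ∑ k, F x k * fderiv ℝ φ x (EuclideanSpace.single k 1) := by
    conv_lhs => rw [← sum_smul_single (F x)]
    simp [map_sum]
  rw [h]
  simp only [divg, fderiv_fun_smul hφ hF, Finset.mul_sum, ← Finset.sum_add_distrib]
  refine Finset.sum_congr rfl fun k _ => ?_
  simp
  ring

lemma divg_sum {ι : Type*} (s : Finset ι)
    {F : ι → EuclideanSpace ℝ (Fin n) → EuclideanSpace ℝ (Fin n)} {x : EuclideanSpace ℝ (Fin n)}
    (hF : ∀ i ∈ s, DifferentiableAt ℝ (F i) x) :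
    divg (fun y => ∑ i ∈ s, F i y) x = ∑ i ∈ s, divg (F i) x := by
  simp only [divg, fderiv_fun_sum hF]
  rw [Finset.sum_comm]
  refine Finset.sum_congr rfl fun k _ => ?_
  simp

lemma ContDiffOn.continuousOn_divg {F : EuclideanSpace ℝ (Fin n) → EuclideanSpace ℝ (Fin n)}
    {s : Set (EuclideanSpace ℝ (Fin n))} (hs : IsOpen s) (hF : ContDiffOn ℝ 1 F s) :
    ContinuousOn (divg F) s := by
  have h : ContinuousOn (fderiv ℝ F) s := hF.continuousOn_fderiv_of_isOpen hs le_rfl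
  unfold divg
  fun_prop

lemma integral_divg_of_hasCompactSupport
    {F : EuclideanSpace ℝ (Fin n) → EuclideanSpace ℝ (Fin n)}
    (hF : ContDiff ℝ 1 F) (hc : HasCompactSupport F) : ∫ x, divg F x = 0 := by
  have hd : Continuous (fderiv ℝ F) := hF.continuous_fderiv one_ne_zero
  have hdc : HasCompactSupport (fderiv ℝ F) := hc.fderiv ℝ
  have key : ∀ k : Fin n, Integrable
      (fun x => fderiv ℝ F x (EuclideanSpace.single k 1) k) := fun k =>
    Continuous.integrable_of_hasCompactSupport (by fun_prop)
      (hdc.comp_left (g := fun L : EuclideanSpace ℝ (Fin n) →L[ℝ] EuclideanSpace ℝ (Fin n) =>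
        L (EuclideanSpace.single k 1) k) (by simp))
  unfold divg
  rw [integral_finsetSum _ fun k _ => key k]
  refine Finset.sum_eq_zero fun k _ => ?_
  have hk : ∀ x, fderiv ℝ (fun y => F y k) x (EuclideanSpace.single k 1)
      = fderiv ℝ F x (EuclideanSpace.single k 1) k := fun x => by
    have := ((EuclideanSpace.proj k : EuclideanSpace ℝ (Fin n) →L[ℝ] ℝ).hasFDerivAt.comp x
      (hF.differentiable one_ne_zero x).hasFDerivAt).fderiv
    rw [show (fun y => F y k) = (EuclideanSpace.proj k : EuclideanSpace ℝ (Fin n) →L[ℝ] ℝ) ∘ F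
      from rfl, this]
    rfl
  have hdk : Differentiable ℝ (fun y => F y k) := by
    have := hF.differentiable one_ne_zero
    fun_prop
  have h := integral_mul_fderiv_eq_neg_fderiv_mul_of_integrable (μ := volume)
    (f := fun _ : EuclideanSpace ℝ (Fin n) => (1 : ℝ)) (g := fun y => F y k)
    (v := EuclideanSpace.single k 1) (by simp) (by simpa [hk] using key k)
    (by
      have : Continuous F := hF.continuous
      simpa using Continuous.integrable_of_hasCompactSupport (f := fun y => F y k) (by fun_prop)
        (hc.comp_left (g := fun v : EuclideanSpace ℝ (Fin n) => v k) (by simp)))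
    (fun x _ => by fun_prop) (fun x _ => hdk x)
  simpa [hk] using h

lemma deriv_smoothTransition_nonneg (x : ℝ) : 0 ≤ deriv Real.smoothTransition x :=
  Real.smoothTransition.monotone.deriv_nonneg

lemma mem_Icc_of_deriv_smoothTransition_ne_zero {x : ℝ}
    (h : deriv Real.smoothTransition x ≠ 0) : x ∈ Icc (0 : ℝ) 1 := by
  by_contra hx
  apply h
  rw [mem_Icc, not_and_or, not_le, not_le] at hx
  rcases hx with hx | hx
  · have : Real.smoothTransition =ᶠ[𝓝 x] fun _ => 0 := by
      filter_upwards [Iio_mem_nhds hx] with y hy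
      exact Real.smoothTransition.zero_of_nonpos (le_of_lt hy)
    simp [this.deriv_eq]
  · have : Real.smoothTransition =ᶠ[𝓝 x] fun _ => 1 := by
      filter_upwards [Ioi_mem_nhds hx] with y hy
      exact Real.smoothTransition.one_of_one_le (le_of_lt hy)
    simp [this.deriv_eq]

/-- The cutoff at depth about `1 / (k + 1)` inside `{ρ < 0}`. The shift by `1` makes it vanish on
a neighbourhood of `{ρ ≥ 0}`. -/
def boundaryCutoff (ρ : EuclideanSpace ℝ (Fin n) → ℝ) (k : ℕ) (x : EuclideanSpace ℝ (Fin n)) : ℝ :=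
  Real.smoothTransition (-((k + 1 : ℝ) * ρ x) - 1)

lemma boundaryCutoff_nonneg (ρ : EuclideanSpace ℝ (Fin n) → ℝ) (k : ℕ)
    (x : EuclideanSpace ℝ (Fin n)) : 0 ≤ boundaryCutoff ρ k x :=
  Real.smoothTransition.nonneg _

lemma boundaryCutoff_le_one (ρ : EuclideanSpace ℝ (Fin n) → ℝ) (k : ℕ)
    (x : EuclideanSpace ℝ (Fin n)) : boundaryCutoff ρ k x ≤ 1 :=
  Real.smoothTransition.le_one _

/-- The factor of `-∇ρ` in the gradient of `boundaryCutoff ρ k`. -/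
def boundaryLayer (ρ : EuclideanSpace ℝ (Fin n) → ℝ) (k : ℕ) (x : EuclideanSpace ℝ (Fin n)) : ℝ :=
  (k + 1 : ℝ) * deriv Real.smoothTransition (-((k + 1 : ℝ) * ρ x) - 1)

lemma hasFDerivAt_boundaryCutoff {ρ : EuclideanSpace ℝ (Fin n) → ℝ} {x : EuclideanSpace ℝ (Fin n)}
    (k : ℕ) (hρ : DifferentiableAt ℝ ρ x) :
    HasFDerivAt (boundaryCutoff ρ k) (-(boundaryLayer ρ k x) • fderiv ℝ ρ x) x := by
  have h1 : HasDerivAt Real.smoothTransition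
      (deriv Real.smoothTransition (-((k + 1 : ℝ) * ρ x) - 1)) (-((k + 1 : ℝ) * ρ x) - 1) :=
    ((Real.smoothTransition.contDiff (n := 1)).differentiable one_ne_zero _).hasDerivAt
  have h2 : HasFDerivAt (fun y => -((k + 1 : ℝ) * ρ y) - 1) (-((k + 1 : ℝ) • fderiv ℝ ρ x)) x :=
    ((hρ.hasFDerivAt.const_mul _).neg).sub_const 1
  have h := h1.comp_hasFDerivAt x h2
  refine h.congr_fderiv ?_
  ext v
  simp [boundaryLayer]
  ring

/-- Integration by parts against the cutoff, for a `C¹` field vanishing off a compact subset of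
the chart domain `U`. -/
lemma integral_boundaryCutoff_mul_divg {Ω U K : Set (EuclideanSpace ℝ (Fin n))}
    {ρ : EuclideanSpace ℝ (Fin n) → ℝ} (hΩ : IsOpen Ω) (hU : IsOpen U)
    (hρ : ContDiffOn ℝ 1 ρ U) (hΩU : Ω ∩ U = {x | x ∈ U ∧ ρ x < 0})
    (hK : IsCompact K) (hKU : K ⊆ U)
    {G : EuclideanSpace ℝ (Fin n) → EuclideanSpace ℝ (Fin n)} (hG : ContDiffOn ℝ 1 G Ω)
    (hGK : ∀ x ∉ K, G x = 0) (hGi : IntegrableOn (divg G) Ω) (k : ℕ) :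
    IntegrableOn (fun x => boundaryCutoff ρ k x * divg G x) Ω ∧
    IntegrableOn (fun x => boundaryLayer ρ k x * fderiv ℝ ρ x (G x)) Ω ∧
      ∫ x in Ω, boundaryCutoff ρ k x * divg G x
        = ∫ x in Ω, boundaryLayer ρ k x * fderiv ℝ ρ x (G x) := by
  have hoff : ∀ x ∉ K, G =ᶠ[𝓝 x] fun _ => 0 := fun x hx => by
    filter_upwards [hK.isClosed.isOpen_compl.mem_nhds hx] with y hy using hGK y hy
  have hρd : ∀ x ∈ U, DifferentiableAt ℝ ρ x := fun x hx =>
    (hρ.differentiableOn one_ne_zero).differentiableAt (hU.mem_nhds hx)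
  set H : EuclideanSpace ℝ (Fin n) → EuclideanSpace ℝ (Fin n) :=
    Ω.indicator fun x => boundaryCutoff ρ k x • G x with hH
  have hHoff : ∀ x ∉ K, H =ᶠ[𝓝 x] fun _ => 0 := fun x hx => by
    filter_upwards [hoff x hx] with y hy
    by_cases hyΩ : y ∈ Ω <;> simp [hH, hyΩ, hy]
  have hHout : ∀ x ∈ K, x ∉ Ω → H =ᶠ[𝓝 x] fun _ => 0 := fun x hx hxΩ => by
    have hxU := hKU hx
    have h0 : 0 ≤ ρ x := by
      by_contra h
      exact hxΩ (hΩU.symm.subset ⟨hxU, not_le.1 h⟩).1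
    have hc : ContinuousAt ρ x := (hρd x hxU).continuousAt
    have : ∀ᶠ y in 𝓝 x, -(1 / (k + 1 : ℝ)) < ρ y :=
      hc.eventually_const_lt (lt_of_lt_of_le (neg_lt_zero.2 (by positivity)) h0)
    filter_upwards [this] with y hy
    by_cases hyΩ : y ∈ Ω
    · have : boundaryCutoff ρ k y = 0 := by
        apply Real.smoothTransition.zero_of_nonpos
        have hk : (0 : ℝ) < k + 1 := by positivity
        have := mul_lt_mul_of_pos_left hy hk
        rw [mul_neg, mul_one_div_cancel hk.ne'] at this
        linarith
      simp [hH, hyΩ, this]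
    · simp [hH, hyΩ]
  have hHin : ∀ x ∈ Ω, H =ᶠ[𝓝 x] fun x => boundaryCutoff ρ k x • G x := fun x hx => by
    filter_upwards [hΩ.mem_nhds hx] with y hy using by simp [hH, hy]
  have hHC : ContDiff ℝ 1 H := by
    rw [contDiff_iff_contDiffAt]
    intro x
    by_cases hxK : x ∈ K
    · by_cases hxΩ : x ∈ Ω
      · refine ContDiffAt.congr_of_eventuallyEq ?_ (hHin x hxΩ)
        have h1 : ContDiffAt ℝ 1 ρ x := hρ.contDiffAt (hU.mem_nhds (hKU hxK))
        have h2 : ContDiffAt ℝ 1 G x := hG.contDiffAt (hΩ.mem_nhds hxΩ)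
        have h3 : ContDiffAt ℝ 1 (boundaryCutoff ρ k) x :=
          Real.smoothTransition.contDiffAt.comp x
            ((contDiffAt_const.mul h1).neg.sub contDiffAt_const)
        exact h3.smul h2
      · exact contDiffAt_const.congr_of_eventuallyEq (hHout x hxK hxΩ)
    · exact contDiffAt_const.congr_of_eventuallyEq (hHoff x hxK)
  have hHK : HasCompactSupport H :=
    HasCompactSupport.intro hK fun x hx => (hHoff x hx).self_of_nhds
  have hdiv : ∀ x ∈ Ω, divg H x
      = boundaryCutoff ρ k x * divg G x - boundaryLayer ρ k x * fderiv ℝ ρ x (G x) := by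
    intro x hx
    by_cases hxK : x ∈ K
    · have h := hasFDerivAt_boundaryCutoff k (hρd x (hKU hxK))
      rw [divg_congr (hHin x hx), divg_smul h.differentiableAt
        ((hG.differentiableOn one_ne_zero).differentiableAt (hΩ.mem_nhds hx)), h.fderiv]
      simp
      ring
    · rw [divg_eq_zero_of_eventually (hHoff x hxK), divg_eq_zero_of_eventually (hoff x hxK),
        hGK x hxK]
      simp
  have hdiv0 : ∀ x ∉ Ω, divg H x = 0 := by
    intro x hx
    by_cases hxK : x ∈ K
    · exact divg_eq_zero_of_eventually (hHout x hxK hx)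
    · exact divg_eq_zero_of_eventually (hHoff x hxK)
  have hHi : Integrable (divg H) := by
    have hcont : Continuous (divg H) :=
      continuousOn_univ.1 (ContDiffOn.continuousOn_divg isOpen_univ hHC.contDiffOn)
    exact hcont.integrable_of_hasCompactSupport
      (HasCompactSupport.intro hK fun x hx => divg_eq_zero_of_eventually (hHoff x hx))
  have hI1 : IntegrableOn (fun x => boundaryCutoff ρ k x * divg G x) Ω := by
    refine Integrable.mono' hGi.norm ?_ ?_
    · have hc : ContinuousOn (fun x => boundaryCutoff ρ k x * divg G x) Ω := by
        intro x hx
        refine ContinuousAt.continuousWithinAt ?_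
        by_cases hxK : x ∈ K
        · exact (hasFDerivAt_boundaryCutoff k (hρd x (hKU hxK))).continuousAt.mul
            ((ContDiffOn.continuousOn_divg hΩ hG).continuousAt (hΩ.mem_nhds hx))
        · have : (fun x => boundaryCutoff ρ k x * divg G x) =ᶠ[𝓝 x] fun _ => 0 := by
            filter_upwards [hK.isClosed.isOpen_compl.mem_nhds hxK] with y hy
            rw [divg_eq_zero_of_eventually (hoff y hy), mul_zero]
          exact continuousAt_const.congr this.symm
      exact hc.aestronglyMeasurable hΩ.measurableSet
    · refine Eventually.of_forall fun x => ?_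
      rw [norm_mul, Real.norm_of_nonneg (boundaryCutoff_nonneg _ _ _)]
      exact mul_le_of_le_one_left (norm_nonneg _) (boundaryCutoff_le_one _ _ _)
  have heq : ∀ x ∈ Ω, boundaryLayer ρ k x * fderiv ℝ ρ x (G x)
      = boundaryCutoff ρ k x * divg G x - divg H x := fun x hx => by
    rw [hdiv x hx]; ring
  have hI2 : IntegrableOn (fun x => boundaryLayer ρ k x * fderiv ℝ ρ x (G x)) Ω :=
    (hI1.sub hHi.integrableOn).congr_fun (fun x hx => (heq x hx).symm) hΩ.measurableSet
  refine ⟨hI1, hI2, ?_⟩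
  rw [setIntegral_congr_fun hΩ.measurableSet heq, integral_sub hI1 hHi.integrableOn,
    setIntegral_eq_integral_of_forall_compl_eq_zero hdiv0,
    integral_divg_of_hasCompactSupport hHC hHK, sub_zero]

lemma boundaryLayer_nonneg (ρ : EuclideanSpace ℝ (Fin n) → ℝ) (k : ℕ)
    (x : EuclideanSpace ℝ (Fin n)) : 0 ≤ boundaryLayer ρ k x :=
  mul_nonneg (by positivity) (deriv_smoothTransition_nonneg _)

lemma neg_le_of_boundaryLayer_ne_zero {ρ : EuclideanSpace ℝ (Fin n) → ℝ} {k : ℕ}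
    {x : EuclideanSpace ℝ (Fin n)} (h : boundaryLayer ρ k x ≠ 0) : -ρ x ≤ 2 / (k + 1 : ℝ) := by
  have h1 := (mem_Icc_of_deriv_smoothTransition_ne_zero (right_ne_zero_of_mul h)).2
  rw [le_div_iff₀ (by positivity)]
  linarith

lemma tendsto_boundaryCutoff {ρ : EuclideanSpace ℝ (Fin n) → ℝ} {x : EuclideanSpace ℝ (Fin n)}
    (h : ρ x < 0) : Tendsto (fun k => boundaryCutoff ρ k x) atTop (𝓝 1) := by
  obtain ⟨k₀, hk₀⟩ := exists_nat_ge (2 / (-ρ x))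
  refine tendsto_const_nhds.congr' ?_
  filter_upwards [eventually_ge_atTop k₀] with k hk
  refine (Real.smoothTransition.one_of_one_le ?_).symm
  have h2 : 2 / (-ρ x) ≤ k + 1 := by
    have : (k₀ : ℝ) ≤ k := by exact_mod_cast hk
    linarith
  rw [div_le_iff₀ (by linarith)] at h2
  linarith

/-- The divergence theorem for a field supported in a boundary chart. The gradient of the cutoff
concentrates at the boundary, where the normal component of `F` is small; its total mass stays
bounded, as one sees by testing with the constant field `v` transversal to the boundary. No surface
measure is needed. -/
lemma setIntegral_divg_eq_zero_of_chart {Ω U K : Set (EuclideanSpace ℝ (Fin n))}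
    {ρ : EuclideanSpace ℝ (Fin n) → ℝ} (hΩ : IsOpen Ω) (hU : IsOpen U)
    (hρ : ContDiffOn ℝ 1 ρ U) (hΩU : Ω ∩ U = {x | x ∈ U ∧ ρ x < 0})
    (hK : IsCompact K) (hKU : K ⊆ U) {v : EuclideanSpace ℝ (Fin n)} {κ : ℝ} (hκ : 0 < κ)
    (hv : ∀ x ∈ U, κ ≤ fderiv ℝ ρ x v)
    {F : EuclideanSpace ℝ (Fin n) → EuclideanSpace ℝ (Fin n)}
    (hFc : ContinuousOn F (closure Ω)) (hF : ContDiffOn ℝ 1 F Ω)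
    (hFK : ∀ x ∉ K, F x = 0) (hFi : IntegrableOn (divg F) Ω)
    (hFt : ∀ x ∈ frontier Ω ∩ U, fderiv ℝ ρ x (F x) = 0) :
    ∫ x in Ω, divg F x = 0 := by
  have hlim : Tendsto (fun k => ∫ x in Ω, boundaryCutoff ρ k x * divg F x) atTop
      (𝓝 (∫ x in Ω, divg F x)) := by
    refine tendsto_integral_of_dominated_convergence (fun x => ‖divg F x‖)
      (fun k => (integral_boundaryCutoff_mul_divg hΩ hU hρ hΩU hK hKU hF hFK hFi
        k).1.aestronglyMeasurable) hFi.norm (fun k => Eventually.of_forall fun x => ?_) ?_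
    · rw [norm_mul, Real.norm_of_nonneg (boundaryCutoff_nonneg _ _ _)]
      exact mul_le_of_le_one_left (norm_nonneg _) (boundaryCutoff_le_one _ _ _)
    · refine (ae_restrict_iff' hΩ.measurableSet).2 (Eventually.of_forall fun x hx => ?_)
      by_cases hxK : x ∈ K
      · have : ρ x < 0 := (hΩU.subset ⟨hx, hKU hxK⟩).2
        simpa using (tendsto_boundaryCutoff this).mul_const (divg F x)
      · have : divg F x = 0 := divg_eq_zero_of_eventually (by
          filter_upwards [hK.isClosed.isOpen_compl.mem_nhds hxK] with y hy using hFK y hy)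
        simp [this]
  obtain ⟨K', hK', hKK', hK'U⟩ := exists_compact_between hK hU hKU
  obtain ⟨θ, hθ0, hθ1, hθ⟩ := exists_contMDiffMap_zero_one_of_isClosed (n := 1)
    (modelWithCornersSelf ℝ (EuclideanSpace ℝ (Fin n)))
    isOpen_interior.isClosed_compl hK.isClosed
    (disjoint_compl_left_iff_subset.2 hKK')
  have hθd : ContDiff ℝ 1 θ := θ.contMDiff.contDiff
  have hθK' : ∀ x ∉ K', θ x = 0 := fun x hx => hθ0 fun h => hx (interior_subset h)
  set G : EuclideanSpace ℝ (Fin n) → EuclideanSpace ℝ (Fin n) := fun x => θ x • v with hGdef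
  have hG : ContDiff ℝ 1 G := hθd.smul contDiff_const
  have hGK' : ∀ x ∉ K', G x = 0 := fun x hx => by simp [hGdef, hθK' x hx]
  have hGi : Integrable (divg G) := by
    refine (continuousOn_univ.1 (ContDiffOn.continuousOn_divg isOpen_univ
      hG.contDiffOn)).integrable_of_hasCompactSupport (HasCompactSupport.intro hK' fun x hx => ?_)
    refine divg_eq_zero_of_eventually ?_
    filter_upwards [hK'.isClosed.isOpen_compl.mem_nhds hx] with y hy using hGK' y hy
  set B : ℝ := ∫ x in Ω, ‖divg G x‖
  have hlim0 : Tendsto (fun k => ∫ x in Ω, boundaryCutoff ρ k x * divg F x) atTop (𝓝 0) := by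
    rw [Metric.tendsto_atTop]
    intro η hη
    have hB : 0 ≤ B := integral_nonneg fun x => norm_nonneg _
    set η' : ℝ := η * κ / (B + 1) with hη'
    have hη'0 : 0 < η' := by positivity
    -- where the normal component of `F` is at least `η'`, the defining function is bounded away
    -- from zero
    obtain ⟨δ, hδ, hδF⟩ : ∃ δ > 0, ∀ x ∈ Ω ∩ K, -ρ x < δ → |fderiv ℝ ρ x (F x)| ≤ η' := by
      have hcont : ContinuousOn (fun x => fderiv ℝ ρ x (F x)) (closure Ω ∩ K) :=
        ((hρ.continuousOn_fderiv_of_isOpen hU le_rfl).mono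
          (fun x hx => hKU hx.2)).clm_apply (hFc.mono inter_subset_left)
      have hcl : IsCompact (closure Ω ∩ K) := hK.inter_left isClosed_closure
      have hA : IsCompact ((closure Ω ∩ K) ∩ (fun x => |fderiv ℝ ρ x (F x)|) ⁻¹' Ici η') :=
        hcl.of_isClosed_subset (hcont.abs.preimage_isClosed_of_isClosed hcl.isClosed isClosed_Ici)
          inter_subset_left
      have hAneg : ∀ x ∈ (closure Ω ∩ K) ∩ (fun x => |fderiv ℝ ρ x (F x)|) ⁻¹' Ici η',
          0 < -ρ x := by
        rintro x ⟨⟨hx1, hx2⟩, hx3⟩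
        have hxΩ : x ∈ Ω := by
          by_contra hxΩ
          have : x ∈ frontier Ω := by rw [hΩ.frontier_eq]; exact ⟨hx1, hxΩ⟩
          simp only [mem_preimage, hFt x ⟨this, hKU hx2⟩, abs_zero, mem_Ici] at hx3
          linarith
        have := (hΩU.subset ⟨hxΩ, hKU hx2⟩).2
        linarith
      obtain ⟨δ, hδ, hδA⟩ := hA.exists_forall_le' (f := fun x => -ρ x)
        ((hρ.continuousOn.mono (fun x hx => hKU hx.1.2)).neg) hAneg
      refine ⟨δ, hδ, fun x hx hxδ => ?_⟩
      by_contra hcon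
      have := hδA x ⟨⟨subset_closure hx.1, hx.2⟩, (not_le.1 hcon).le⟩
      linarith
    obtain ⟨k₀, hk₀⟩ := exists_nat_gt (2 / δ)
    refine ⟨k₀, fun k hk => ?_⟩
    obtain ⟨-, hI2, heq⟩ := integral_boundaryCutoff_mul_divg hΩ hU hρ hΩU hK hKU hF hFK hFi k
    obtain ⟨hJ1, hJ2, heqG⟩ := integral_boundaryCutoff_mul_divg hΩ hU hρ hΩU hK' hK'U
      hG.contDiffOn hGK' hGi.integrableOn k
    rw [dist_zero_right, heq]
    have hpt : ∀ x ∈ Ω, ‖boundaryLayer ρ k x * fderiv ℝ ρ x (F x)‖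
        ≤ η' / κ * (boundaryLayer ρ k x * fderiv ℝ ρ x (G x)) := by
      intro x hx
      have hGnn : 0 ≤ fderiv ℝ ρ x (G x) := by
        by_cases hxK' : x ∈ K'
        · simp only [hGdef, map_smul, smul_eq_mul]
          exact mul_nonneg (hθ x).1 (hκ.le.trans (hv x (hK'U hxK')))
        · simp [hGK' x hxK']
      by_cases hl : boundaryLayer ρ k x = 0
      · simp [hl]
      by_cases hxK : x ∈ K
      · have hsmall : -ρ x < δ := by
          refine (neg_le_of_boundaryLayer_ne_zero hl).trans_lt ?_
          rw [div_lt_iff₀ (by positivity)]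
          rw [div_lt_iff₀ hδ] at hk₀
          have : (k₀ : ℝ) ≤ k := by exact_mod_cast hk
          nlinarith
        have h1 := hδF x ⟨hx, hxK⟩ hsmall
        have h2 : fderiv ℝ ρ x (G x) = fderiv ℝ ρ x v := by
          have : θ x = 1 := hθ1 hxK
          simp [hGdef, this]
        rw [norm_mul, Real.norm_of_nonneg (boundaryLayer_nonneg _ _ _), Real.norm_eq_abs, h2]
        have h3 : η' ≤ η' / κ * fderiv ℝ ρ x v := by
          rw [div_mul_eq_mul_div, le_div_iff₀ hκ]
          exact mul_le_mul_of_nonneg_left (hv x (hKU hxK)) hη'0.le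
        calc boundaryLayer ρ k x * |fderiv ℝ ρ x (F x)|
            ≤ boundaryLayer ρ k x * (η' / κ * fderiv ℝ ρ x v) :=
              mul_le_mul_of_nonneg_left (h1.trans h3) (boundaryLayer_nonneg _ _ _)
          _ = _ := by ring
      · rw [hFK x hxK]
        simp only [map_zero, mul_zero, norm_zero]
        exact mul_nonneg (by positivity) (mul_nonneg (boundaryLayer_nonneg _ _ _) hGnn)
    calc ‖∫ x in Ω, boundaryLayer ρ k x * fderiv ℝ ρ x (F x)‖
        ≤ ∫ x in Ω, ‖boundaryLayer ρ k x * fderiv ℝ ρ x (F x)‖ := norm_integral_le_integral_norm _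
      _ ≤ ∫ x in Ω, η' / κ * (boundaryLayer ρ k x * fderiv ℝ ρ x (G x)) :=
          setIntegral_mono_on hI2.norm (hJ2.const_mul _) hΩ.measurableSet hpt
      _ = η' / κ * ∫ x in Ω, boundaryCutoff ρ k x * divg G x := by
          rw [integral_const_mul, heqG]
      _ ≤ η' / κ * B := by
          refine mul_le_mul_of_nonneg_left ?_ (by positivity)
          refine integral_mono hJ1 hGi.integrableOn.norm fun x => ?_
          refine (le_abs_self _).trans ?_
          rw [abs_mul, abs_of_nonneg (boundaryCutoff_nonneg _ _ _)]
          exact mul_le_of_le_one_left (abs_nonneg _) (boundaryCutoff_le_one _ _ _)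
      _ < η := by
          rw [hη', show η * κ / (B + 1) / κ * B = η * (B / (B + 1)) by field_simp]
          refine mul_lt_of_lt_one_right hη ?_
          rw [div_lt_one (by positivity)]
          linarith
  exact tendsto_nhds_unique hlim hlim0

end Divergence

section C2Domain

open Filter Topology

variable {n : ℕ} {Ω : Set (EuclideanSpace ℝ (Fin n))}

lemma IsBoundedC2Domain.isCompact_closure (hΩ : IsBoundedC2Domain Ω) : IsCompact (closure Ω) :=
  hΩ.isBounded.isCompact_closure

/-- Near a boundary point the domain is `{ρ < 0}` for a single `ρ` that is a local defining
function at all nearby boundary points and increases strictly in a fixed direction `v`. -/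
lemma IsBoundedC2Domain.exists_chart (hΩ : IsBoundedC2Domain Ω) {z : EuclideanSpace ℝ (Fin n)}
    (hz : z ∈ frontier Ω) :
    ∃ (U : Set (EuclideanSpace ℝ (Fin n))) (ρ : EuclideanSpace ℝ (Fin n) → ℝ)
      (v : EuclideanSpace ℝ (Fin n)) (κ : ℝ), z ∈ U ∧ IsOpen U ∧ 0 < κ ∧
      (∀ x ∈ U, κ ≤ fderiv ℝ ρ x v) ∧ ContDiffOn ℝ 1 ρ U ∧
      Ω ∩ U = {x | x ∈ U ∧ ρ x < 0} ∧
      ∀ x ∈ frontier Ω ∩ U, IsLocalDefiningFunction Ω x U ρ := by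
  obtain ⟨U, ρ, h⟩ := hΩ.boundary z hz
  have hfc : ContinuousOn (fun x => fderiv ℝ ρ x (∇ ρ z)) U :=
    (h.contDiffOn.continuousOn_fderiv_of_isOpen h.isOpen (by norm_num)).clm_apply
      continuousOn_const
  have hz0 : fderiv ℝ ρ z (∇ ρ z) = ‖∇ ρ z‖ ^ 2 := by
    rw [← inner_gradient_left, real_inner_self_eq_norm_sq]
  have hpos : 0 < ‖∇ ρ z‖ := norm_pos_iff.2 h.gradient_ne_zero
  set κ : ℝ := ‖∇ ρ z‖ ^ 2 / 2 with hκ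
  have hκ0 : 0 < κ := by positivity
  obtain ⟨V, hVsub, hVo, hzV⟩ : ∃ V ⊆ U ∩ {x | κ < fderiv ℝ ρ x (∇ ρ z)}, IsOpen V ∧ z ∈ V := by
    refine mem_nhds_iff.1 (inter_mem (h.isOpen.mem_nhds h.mem) ?_)
    refine (hfc.continuousAt (h.isOpen.mem_nhds h.mem)).eventually_const_lt ?_
    change κ < fderiv ℝ ρ z (∇ ρ z)
    rw [hz0, hκ]
    linarith [pow_pos hpos 2]
  have hVU : V ⊆ U := fun x hx => (hVsub hx).1
  have hΩV : Ω ∩ V = {x | x ∈ V ∧ ρ x < 0} := by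
    ext x
    constructor
    · rintro ⟨h1, h2⟩
      exact ⟨h2, (h.inter_eq.subset ⟨h1, hVU h2⟩).2⟩
    · rintro ⟨h1, h2⟩
      exact ⟨(h.inter_eq.symm.subset ⟨hVU h1, h2⟩).1, h1⟩
  refine ⟨V, ρ, ∇ ρ z, κ, hzV, hVo, hκ0, fun x hx => (hVsub hx).2.le,
    (h.contDiffOn.mono hVU).of_le (by norm_num), hΩV, ?_⟩
  rintro x ⟨hxf, hxV⟩
  rw [hΩ.isOpen.frontier_eq] at hxf
  refine ⟨hVo, hxV, h.contDiffOn.mono hVU, ?_, ?_, hΩV⟩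
  · refine le_antisymm ?_ ?_
    · have hxc : x ∈ closure (Ω ∩ V) := by
        rw [mem_closure_iff_nhdsWithin_neBot, nhdsWithin_inter_of_mem'
          (mem_nhdsWithin_of_mem_nhds (hVo.mem_nhds hxV))]
        exact mem_closure_iff_nhdsWithin_neBot.1 hxf.1
      refine closure_minimal (s := Ω ∩ V) (t := {y | ρ y ≤ 0} ∪ Vᶜ) ?_ ?_ hxc |>.resolve_right
        (fun h => h hxV)
      · exact fun y hy => Or.inl (hΩV.subset hy).2.le
      · rw [← isOpen_compl_iff]
        have : ({y | ρ y ≤ 0} ∪ Vᶜ)ᶜ = V ∩ ρ ⁻¹' Ioi 0 := by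
          ext y; simp [and_comm]
        rw [this]
        exact (h.contDiffOn.continuousOn.mono hVU).isOpen_inter_preimage hVo isOpen_Ioi
    · by_contra hneg
      exact hxf.2 (hΩV.symm.subset ⟨hxV, not_le.1 hneg⟩).1
  · intro h0
    have h1 := (hVsub hxV).2
    simp only [mem_ofPred_eq, ← inner_gradient_left, h0, inner_zero_left] at h1
    linarith

/-- At a boundary point `closure Ω` contains an open truncated cone with that vertex. -/
lemma IsBoundedC2Domain.uniqueDiffOn_closure (hΩ : IsBoundedC2Domain Ω) :
    UniqueDiffOn ℝ (closure Ω) := by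
  intro z hz
  by_cases hzΩ : z ∈ Ω
  · exact (hΩ.isOpen.uniqueDiffWithinAt hzΩ).mono subset_closure
  have hzf : z ∈ frontier Ω := by rw [hΩ.isOpen.frontier_eq]; exact ⟨hz, hzΩ⟩
  obtain ⟨U, ρ, v, κ, hzU, hU, hκ, hv, hρ, hΩU, hloc⟩ := hΩ.exists_chart hzf
  have hρd : HasFDerivAt ρ (fderiv ℝ ρ z) z :=
    ((hρ.differentiableOn one_ne_zero).differentiableAt (hU.mem_nhds hzU)).hasFDerivAt
  have hρz : ρ z = 0 := (hloc z ⟨hzf, hzU⟩).eq_zero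
  set L := fderiv ℝ ρ z
  have hv0 : v ≠ 0 := by
    rintro rfl
    have := hv z hzU
    simp at this
    linarith
  have hnv : 0 < ‖v‖ := norm_pos_iff.2 hv0
  set σ : ℝ := κ / (2 * ‖v‖) with hσ
  have hσ0 : 0 < σ := by positivity
  obtain ⟨δ, hδ, hball⟩ := Metric.mem_nhds_iff.1
    (inter_mem (hU.mem_nhds hzU) (hρd.isLittleO.def hσ0))
  set A : Set (EuclideanSpace ℝ (Fin n)) :=
    {x | σ * ‖x - z‖ + L (x - z) < 0} ∩ Metric.ball z δ with hA
  have hAΩ : A ⊆ closure Ω := by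
    rintro x ⟨hx1, hx2⟩
    obtain ⟨hxU, hx3⟩ := hball hx2
    refine subset_closure (hΩU.symm.subset ⟨hxU, ?_⟩).1
    simp only [mem_ofPred_eq, hρz, sub_zero, Real.norm_eq_abs] at hx1 hx3
    linarith [(abs_le.1 hx3).2]
  have hAconv : Convex ℝ A := by
    have h1 : ConvexOn ℝ univ (fun x : EuclideanSpace ℝ (Fin n) => σ * ‖x - z‖ + L (x - z)) := by
      refine ConvexOn.add ?_ ?_
      · have := (convexOn_univ_norm (E := EuclideanSpace ℝ (Fin n))).translate_left (-z)
        simpa [Function.comp_def, sub_eq_add_neg] using this.smul hσ0.le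
      · simp only [map_sub]
        simp only [sub_eq_add_neg]
        exact ConvexOn.add_const (f := fun x => L x) (L.toLinearMap.convexOn convex_univ) (-L z)
    have h2 := h1.convex_lt 0
    simp only [mem_univ, true_and] at h2
    exact h2.inter (convex_ball z δ)
  have hAopen : IsOpen A :=
    (isOpen_lt (by fun_prop) continuous_const).inter Metric.isOpen_ball
  -- the open ray from `z` in the direction `-v` stays in the cone
  have hray : ∀ s : ℝ, 0 < s → s * ‖v‖ < δ → z - s • v ∈ A := by
    intro s hs hsδ
    refine ⟨?_, ?_⟩
    · have h1 : ‖z - s • v - z‖ = s * ‖v‖ := by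
        rw [sub_sub_cancel_left, norm_neg, norm_smul, Real.norm_of_nonneg hs.le]
      have h2 : L (z - s • v - z) = -(s * L v) := by
        rw [sub_sub_cancel_left]; simp
      have h3 : σ * (s * ‖v‖) = s * (κ / 2) := by rw [hσ]; field_simp
      simp only [mem_ofPred_eq]
      rw [h1, h2, h3]
      have := hv z hzU
      nlinarith
    · rw [Metric.mem_ball, dist_eq_norm, sub_sub_cancel_left, norm_neg, norm_smul,
        Real.norm_of_nonneg hs.le]
      exact hsδ
  have hzA : z ∈ closure A := by
    have hc : Tendsto (fun s : ℝ => z - s • v) (𝓝[>] 0) (𝓝 z) := by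
      have : Continuous fun s : ℝ => z - s • v := by fun_prop
      simpa using (this.tendsto 0).mono_left nhdsWithin_le_nhds
    refine mem_closure_of_tendsto hc ?_
    have hsmall : ∀ᶠ s : ℝ in 𝓝[>] 0, s < δ / ‖v‖ :=
      nhdsWithin_le_nhds (Iio_mem_nhds (by positivity))
    filter_upwards [self_mem_nhdsWithin, hsmall] with s hs hs2
    exact hray s hs ((lt_div_iff₀ hnv).1 hs2)
  refine (uniqueDiffWithinAt_convex hAconv ?_ hzA).mono hAΩ
  rw [hAopen.interior_eq]
  exact closure_nonempty_iff.1 ⟨z, hzA⟩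

/-- A vector field that is continuous on `closure Ω`, `C¹` with integrable divergence in `Ω`, and
tangent to the boundary. -/
structure IsTangentialField (Ω : Set (EuclideanSpace ℝ (Fin n)))
    (F : EuclideanSpace ℝ (Fin n) → EuclideanSpace ℝ (Fin n)) : Prop where
  continuousOn : ContinuousOn F (closure Ω)
  contDiffOn : ContDiffOn ℝ 1 F Ω
  integrableOn_divg : IntegrableOn (divg F) Ω
  tangent : ∀ z ∈ frontier Ω, ∀ ν, IsOuterUnitNormal Ω z ν → ⟪F z, ν⟫_ℝ = 0

lemma IsTangentialField.smul {F : EuclideanSpace ℝ (Fin n) → EuclideanSpace ℝ (Fin n)}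
    (hF : IsTangentialField Ω F) (hΩ : IsBoundedC2Domain Ω)
    {χ : EuclideanSpace ℝ (Fin n) → ℝ} (hχ : ContDiff ℝ 1 χ) :
    IsTangentialField Ω (fun x => χ x • F x) := by
  have hdiv : ∀ x ∈ Ω, divg (fun x => χ x • F x) x = χ x * divg F x + fderiv ℝ χ x (F x) :=
    fun x hx => divg_smul (hχ.differentiable one_ne_zero x)
      ((hF.contDiffOn.differentiableOn one_ne_zero).differentiableAt (hΩ.isOpen.mem_nhds hx))
  refine ⟨hχ.continuous.continuousOn.smul hF.continuousOn, hχ.contDiffOn.smul hF.contDiffOn,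
    ?_, fun z hz ν hν => by rw [inner_smul_left, hF.tangent z hz ν hν, mul_zero]⟩
  refine IntegrableOn.congr_fun ?_ (fun x hx => (hdiv x hx).symm) hΩ.isOpen.measurableSet
  refine IntegrableOn.add ?_ ?_
  · obtain ⟨C, hC⟩ := hΩ.isCompact_closure.exists_bound_of_continuousOn hχ.continuous.continuousOn
    refine Integrable.bdd_mul hF.integrableOn_divg (c := C)
      hχ.continuous.aestronglyMeasurable ?_
    exact (ae_restrict_iff' hΩ.isOpen.measurableSet).2
      (Eventually.of_forall fun x hx => hC x (subset_closure hx))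
  · exact (((hχ.continuous_fderiv one_ne_zero).continuousOn.clm_apply
      hF.continuousOn).integrableOn_compact hΩ.isCompact_closure).mono_set subset_closure

/-- **Divergence theorem** for fields tangent to the boundary. -/
theorem IsTangentialField.setIntegral_divg_eq_zero (hΩ : IsBoundedC2Domain Ω)
    {F : EuclideanSpace ℝ (Fin n) → EuclideanSpace ℝ (Fin n)} (hF : IsTangentialField Ω F) :
    ∫ x in Ω, divg F x = 0 := by
  have hloc : ∀ z ∈ closure Ω, ∃ V, IsOpen V ∧ z ∈ V ∧ ∀ χ : EuclideanSpace ℝ (Fin n) → ℝ,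
      ContDiff ℝ 1 χ → tsupport χ ⊆ V → ∫ x in Ω, divg (fun x => χ x • F x) x = 0 := by
    intro z hz
    by_cases hzΩ : z ∈ Ω
    · refine ⟨Ω, hΩ.isOpen, hzΩ, fun χ hχ hsupp => ?_⟩
      have hK : IsCompact (tsupport χ) :=
        hΩ.isCompact_closure.of_isClosed_subset (isClosed_tsupport χ)
          (hsupp.trans subset_closure)
      have hzero : ∀ x ∉ tsupport χ, χ x = 0 := fun x hx => image_eq_zero_of_notMem_tsupport hx
      have hoff : ∀ x ∉ tsupport χ, (fun x => χ x • F x) =ᶠ[𝓝 x] fun _ => 0 := fun x hx => by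
        filter_upwards [(isClosed_tsupport χ).isOpen_compl.mem_nhds hx] with y hy
        simp [hzero y hy]
      have hC : ContDiff ℝ 1 fun x => χ x • F x := by
        rw [contDiff_iff_contDiffAt]
        intro x
        by_cases hx : x ∈ tsupport χ
        · exact hχ.contDiffAt.smul (hF.contDiffOn.contDiffAt (hΩ.isOpen.mem_nhds (hsupp hx)))
        · exact contDiffAt_const.congr_of_eventuallyEq (hoff x hx)
      rw [setIntegral_eq_integral_of_forall_compl_eq_zero fun x hx =>
        divg_eq_zero_of_eventually (hoff x fun h => hx (hsupp h))]
      exact integral_divg_of_hasCompactSupport hC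
        (HasCompactSupport.intro hK fun x hx => by simp [hzero x hx])
    · have hzf : z ∈ frontier Ω := by rw [hΩ.isOpen.frontier_eq]; exact ⟨hz, hzΩ⟩
      obtain ⟨U, ρ, v, κ, hzU, hU, hκ, hv, hρ, hΩU, hlocU⟩ := hΩ.exists_chart hzf
      -- the ball makes the support of `χ` compact
      refine ⟨U ∩ Metric.ball z 1, hU.inter Metric.isOpen_ball,
        ⟨hzU, Metric.mem_ball_self one_pos⟩, fun χ hχ hsupp => ?_⟩
      have hK : IsCompact (tsupport χ) :=
        Metric.isCompact_of_isClosed_isBounded (isClosed_tsupport χ)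
          (Metric.isBounded_ball.subset (hsupp.trans inter_subset_right))
      have hG := hF.smul hΩ hχ
      refine setIntegral_divg_eq_zero_of_chart hΩ.isOpen hU hρ hΩU hK
        (hsupp.trans inter_subset_left) hκ hv hG.continuousOn hG.contDiffOn
        (fun x hx => by simp [image_eq_zero_of_notMem_tsupport hx]) hG.integrableOn_divg ?_
      intro x hx
      have hdef := hlocU x hx
      have := hG.tangent x hx.1 _ ⟨U, ρ, hdef, rfl⟩
      rw [inner_smul_right, mul_eq_zero, inv_eq_zero, norm_eq_zero] at this
      rw [← inner_gradient_left, real_inner_comm]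
      exact this.resolve_left hdef.gradient_ne_zero
  choose! V hVo hzV hV using hloc
  obtain ⟨t, htcover⟩ := hΩ.isCompact_closure.elim_nhds_subcover' (fun z _ => V z)
    (fun z hz => (hVo z hz).mem_nhds (hzV z hz))
  obtain ⟨χ, hχ⟩ := SmoothPartitionOfUnity.exists_isSubordinate
    (modelWithCornersSelf ℝ (EuclideanSpace ℝ (Fin n))) (s := closure Ω) isClosed_closure
    (fun i : t => V i.1) (fun i => hVo _ i.1.2) (by
      intro x hx
      have hx' := htcover hx
      simp only [mem_iUnion] at hx'
      obtain ⟨i, hi, hxi⟩ := hx'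
      exact mem_iUnion.2 ⟨⟨i, hi⟩, hxi⟩)
  have hχd : ∀ i, ContDiff ℝ 1 (χ i) := fun i =>
    (χ i).contMDiff.contDiff.of_le (by exact_mod_cast le_top)
  have hsum : ∀ x ∈ Ω, divg F x = ∑ i, divg (fun y => χ i y • F y) x := by
    intro x hx
    have hFd : DifferentiableAt ℝ F x :=
      (hF.contDiffOn.differentiableOn one_ne_zero).differentiableAt (hΩ.isOpen.mem_nhds hx)
    rw [← divg_sum (F := fun i y => χ i y • F y) _
      fun i _ => ((hχd i).differentiable one_ne_zero x).smul hFd]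
    refine divg_congr ?_
    filter_upwards [hΩ.isOpen.mem_nhds hx] with y hy
    have h1 : ∑ i, χ i y = 1 := by
      rw [← finsum_eq_sum_of_fintype]
      exact χ.sum_eq_one (subset_closure hy)
    rw [← Finset.sum_smul, h1, one_smul]
  rw [setIntegral_congr_fun hΩ.isOpen.measurableSet hsum,
    integral_finsetSum _ fun i _ => (hF.smul hΩ (hχd i)).integrableOn_divg]
  exact Finset.sum_eq_zero fun i _ => hV _ i.1.2 _ (hχd i) (hχ i)

end C2Domain

/-! ### Continuous functions on a space-time cylinder -/

section Cylinder

open Filter Topology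

variable {n : ℕ} {Ω : Set (EuclideanSpace ℝ (Fin n))} {τ : ℝ}
  {F : Type*} [NormedAddCommGroup F]
  {f : ℝ → EuclideanSpace ℝ (Fin n) → F}

lemma continuousOn_time_slice
    (hf : ContinuousOn (fun p : ℝ × EuclideanSpace ℝ (Fin n) => f p.1 p.2)
      (Icc 0 τ ×ˢ closure Ω)) {z : EuclideanSpace ℝ (Fin n)} (hz : z ∈ closure Ω) :
    ContinuousOn (fun s => f s z) (Icc 0 τ) :=
  hf.comp (f := fun s : ℝ => (s, z)) (by fun_prop) fun _ hs => ⟨hs, hz⟩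

lemma continuousOn_space_slice
    (hf : ContinuousOn (fun p : ℝ × EuclideanSpace ℝ (Fin n) => f p.1 p.2)
      (Icc 0 τ ×ˢ closure Ω)) {s : ℝ} (hs : s ∈ Icc 0 τ) :
    ContinuousOn (f s) (closure Ω) :=
  hf.comp (f := fun z : EuclideanSpace ℝ (Fin n) => (s, z)) (by fun_prop) fun _ hz => ⟨hs, hz⟩

lemma intervalIntegrable_time_slice
    (hf : ContinuousOn (fun p : ℝ × EuclideanSpace ℝ (Fin n) => f p.1 p.2)
      (Icc 0 τ ×ˢ closure Ω)) {z : EuclideanSpace ℝ (Fin n)} (hz : z ∈ closure Ω) {t : ℝ}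
    (ht : t ∈ Icc 0 τ) : IntervalIntegrable (fun s => f s z) volume 0 t := by
  refine ContinuousOn.intervalIntegrable ?_
  rw [uIcc_of_le ht.1]
  exact (continuousOn_time_slice hf hz).mono (Icc_subset_Icc_right ht.2)

lemma integrableOn_space_slice (hK : IsCompact (closure Ω))
    (hf : ContinuousOn (fun p : ℝ × EuclideanSpace ℝ (Fin n) => f p.1 p.2)
      (Icc 0 τ ×ˢ closure Ω)) {s : ℝ} (hs : s ∈ Icc 0 τ) : IntegrableOn (f s) Ω :=
  ((continuousOn_space_slice hf hs).integrableOn_compact hK).mono_set subset_closure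

lemma integrableOn_cylinder (hK : IsCompact (closure Ω))
    (hf : ContinuousOn (fun p : ℝ × EuclideanSpace ℝ (Fin n) => f p.1 p.2)
      (Icc 0 τ ×ˢ closure Ω)) {t : ℝ} (ht : t ∈ Icc 0 τ) :
    IntegrableOn (fun p : ℝ × EuclideanSpace ℝ (Fin n) => f p.1 p.2) (Ioc 0 t ×ˢ Ω) :=
  (hf.integrableOn_compact (isCompact_Icc.prod hK)).mono_set
    (prod_mono (Ioc_subset_Icc_self.trans (Icc_subset_Icc_right ht.2)) subset_closure)

lemma integrable_cylinder_prod (hK : IsCompact (closure Ω))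
    (hf : ContinuousOn (fun p : ℝ × EuclideanSpace ℝ (Fin n) => f p.1 p.2)
      (Icc 0 τ ×ˢ closure Ω)) {t : ℝ} (ht : t ∈ Icc 0 τ) :
    Integrable (Function.uncurry f)
      ((volume.restrict (Ioc 0 t)).prod (volume.restrict Ω)) := by
  rw [Measure.prod_restrict, ← Measure.volume_eq_prod]
  exact integrableOn_cylinder hK hf ht

variable [NormedSpace ℝ F]

lemma intervalIntegrable_setIntegral (hK : IsCompact (closure Ω))
    (hf : ContinuousOn (fun p : ℝ × EuclideanSpace ℝ (Fin n) => f p.1 p.2)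
      (Icc 0 τ ×ˢ closure Ω)) {t : ℝ} (ht : t ∈ Icc 0 τ) :
    IntervalIntegrable (fun s => ∫ z in Ω, f s z) volume 0 t := by
  rw [intervalIntegrable_iff_integrableOn_Ioc_of_le ht.1]
  exact (integrable_cylinder_prod hK hf ht).integral_prod_left

lemma intervalIntegral_setIntegral_swap (hK : IsCompact (closure Ω))
    (hf : ContinuousOn (fun p : ℝ × EuclideanSpace ℝ (Fin n) => f p.1 p.2)
      (Icc 0 τ ×ˢ closure Ω)) {t : ℝ} (ht : t ∈ Icc 0 τ) :
    ∫ s in (0 : ℝ)..t, ∫ z in Ω, f s z = ∫ z in Ω, ∫ s in (0 : ℝ)..t, f s z := by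
  refine intervalIntegral_integral_swap ?_
  rw [uIoc_of_le ht.1]
  exact integrable_cylinder_prod hK hf ht

/-- The time primitive of a function continuous on the cylinder is continuous on the cylinder. -/
lemma continuousOn_time_primitive (hτ : 0 ≤ τ)
    (hf : ContinuousOn (fun p : ℝ × EuclideanSpace ℝ (Fin n) => f p.1 p.2)
      (Icc 0 τ ×ˢ closure Ω)) :
    ContinuousOn (fun p : ℝ × EuclideanSpace ℝ (Fin n) => ∫ s in (0 : ℝ)..p.1, f s p.2)
      (Icc 0 τ ×ˢ closure Ω) := by
  set g : (Icc 0 τ ×ˢ closure Ω : Set (ℝ × EuclideanSpace ℝ (Fin n))) → ℝ → F :=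
    fun q s => f (projIcc 0 τ hτ s) q.1.2 with hg
  have hgc : Continuous (Function.uncurry g) := by
    have h := hf.comp_continuous
      (f := fun q : (Icc 0 τ ×ˢ closure Ω : Set (ℝ × EuclideanSpace ℝ (Fin n))) × ℝ =>
        ((projIcc 0 τ hτ q.2 : ℝ), q.1.1.2)) (by fun_prop)
      (fun q => ⟨(projIcc 0 τ hτ q.2).2, q.1.2.2⟩)
    exact h
  have h := intervalIntegral.continuous_parametric_intervalIntegral_of_continuous
    (μ := volume) (a₀ := 0) hgc
    (s := fun q : (Icc 0 τ ×ˢ closure Ω : Set (ℝ × EuclideanSpace ℝ (Fin n))) => q.1.1)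
    (by fun_prop)
  rw [continuousOn_iff_continuous_domRestrict]
  refine h.congr fun q => ?_
  refine intervalIntegral.integral_congr fun s hs => ?_
  rw [uIcc_of_le q.2.1.1] at hs
  simp only [hg, projIcc_of_mem hτ ⟨hs.1, hs.2.trans q.2.1.2⟩]

lemma hasDerivWithinAt_time_primitive [CompleteSpace F] {g : ℝ → F}
    (hg : ContinuousOn g (Icc 0 τ)) {t : ℝ} (ht : t ∈ Icc 0 τ) :
    HasDerivWithinAt (fun r => ∫ s in (0 : ℝ)..r, g s) (g t) (Icc 0 τ) t := by
  -- makes `𝓝[Icc 0 τ] t` available as a filter for the fundamental theorem of calculus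
  have : Fact (t ∈ Icc 0 τ) := ⟨ht⟩
  refine intervalIntegral.integral_hasDerivWithinAt_right (s := Icc 0 τ) (t := Icc 0 τ)
    (ContinuousOn.intervalIntegrable ?_) ?_ (hg t ht)
  · rw [uIcc_of_le ht.1]
    exact hg.mono (Icc_subset_Icc_right ht.2)
  · exact ⟨Icc 0 τ, self_mem_nhdsWithin, hg.aestronglyMeasurable measurableSet_Icc⟩

/-- The fundamental theorem of calculus in time, integrated over the domain. -/
lemma setIntegral_sub_eq_intervalIntegral [CompleteSpace F] (hΩ : IsOpen Ω)
    (hK : IsCompact (closure Ω))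
    (hf : ContinuousOn (fun p : ℝ × EuclideanSpace ℝ (Fin n) => f p.1 p.2)
      (Icc 0 τ ×ˢ closure Ω))
    {f' : ℝ → EuclideanSpace ℝ (Fin n) → F}
    (hf' : ContinuousOn (fun p : ℝ × EuclideanSpace ℝ (Fin n) => f' p.1 p.2)
      (Icc 0 τ ×ˢ closure Ω))
    (hd : ∀ z ∈ Ω, ∀ s ∈ Icc 0 τ, HasDerivWithinAt (fun r => f r z) (f' s z) (Icc 0 τ) s)
    {t : ℝ} (ht : t ∈ Icc 0 τ) :
    ∫ z in Ω, f t z = (∫ z in Ω, f 0 z) + ∫ s in (0 : ℝ)..t, ∫ z in Ω, f' s z := by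
  have h0 : (0 : ℝ) ∈ Icc 0 τ := ⟨le_rfl, ht.1.trans ht.2⟩
  rw [intervalIntegral_setIntegral_swap hK hf' ht, ← sub_eq_iff_eq_add', ← integral_sub
    (integrableOn_space_slice hK hf ht) (integrableOn_space_slice hK hf h0)]
  refine setIntegral_congr_fun hΩ.measurableSet fun z hz => ?_
  refine (intervalIntegral.integral_eq_sub_of_hasDerivAt_of_le ht.1
    ((continuousOn_time_slice hf (subset_closure hz)).mono (Icc_subset_Icc_right ht.2))
    (fun s hs => ?_) (intervalIntegrable_time_slice hf' (subset_closure hz) ht)).symm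
  exact (hd z hz s ⟨hs.1.le, hs.2.le.trans ht.2⟩).hasDerivAt
    (Icc_mem_nhds hs.1 (hs.2.trans_le ht.2))

/-- Differentiation of a time primitive with respect to space, at interior points. -/
lemma hasFDerivAt_time_primitive (hΩ : IsOpen Ω) (hK : IsCompact (closure Ω))
    {u : ℝ → EuclideanSpace ℝ (Fin n) → ℝ}
    {g : ℝ → EuclideanSpace ℝ (Fin n) → EuclideanSpace ℝ (Fin n)}
    (hu : ContinuousOn (fun p : ℝ × EuclideanSpace ℝ (Fin n) => u p.1 p.2)
      (Icc 0 τ ×ˢ closure Ω))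
    (hg : ContinuousOn (fun p : ℝ × EuclideanSpace ℝ (Fin n) => g p.1 p.2)
      (Icc 0 τ ×ˢ closure Ω))
    (hd : ∀ s ∈ Icc 0 τ, ∀ z ∈ Ω, HasFDerivAt (u s) (innerSL ℝ (g s z)) z)
    {t : ℝ} (ht : t ∈ Icc 0 τ) {z : EuclideanSpace ℝ (Fin n)} (hz : z ∈ Ω) :
    HasFDerivAt (fun x => ∫ s in (0 : ℝ)..t, u s x)
      (innerSL ℝ (∫ s in (0 : ℝ)..t, g s z)) z := by
  rw [← ContinuousLinearMap.intervalIntegral_comp_comm _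
    (intervalIntegrable_time_slice hg (subset_closure hz) ht)]
  obtain ⟨C, hC⟩ := (isCompact_Icc.prod hK).exists_bound_of_continuousOn hg
  have hsub : ∀ s ∈ uIoc 0 t, s ∈ Icc 0 τ := fun s hs => by
    rw [uIoc_of_le ht.1] at hs
    exact ⟨hs.1.le, hs.2.trans ht.2⟩
  refine intervalIntegral.hasFDerivAt_integral_of_dominated_of_fderiv_le
    (F := fun x s => u s x) (F' := fun x s => innerSL ℝ (g s x))
    (bound := fun _ => C) (hΩ.mem_nhds hz) ?_
    (intervalIntegrable_time_slice hu (subset_closure hz) ht) ?_ ?_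
    (by simp) ?_
  · filter_upwards [hΩ.mem_nhds hz] with x hx
    exact (intervalIntegrable_iff.1
      (intervalIntegrable_time_slice hu (subset_closure hx) ht)).aestronglyMeasurable
  · exact (innerSL ℝ).continuous.comp_aestronglyMeasurable (intervalIntegrable_iff.1
      (intervalIntegrable_time_slice hg (subset_closure hz) ht)).aestronglyMeasurable
  · refine Eventually.of_forall fun s hs x hx => ?_
    rw [innerSL_apply_norm]
    exact hC (s, x) ⟨hsub s hs, subset_closure hx⟩
  · exact Eventually.of_forall fun s hs x hx => hd s (hsub s hs) x hx

end Cylinder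

/-! ### Space and time derivatives of a classical solution -/

section SpaceDerivatives

open Filter Topology

variable {n : ℕ} {Ω : Set (EuclideanSpace ℝ (Fin n))} {τ : ℝ}

/-- On the cylinder `[0, τ] × closure Ω` the function `u` is continuous, and `g` and `l` are
continuous extensions of its spatial gradient and Laplacian from `[0, τ] × Ω`. -/
structure HasSpaceDerivs (Ω : Set (EuclideanSpace ℝ (Fin n))) (τ : ℝ)
    (u : ℝ → EuclideanSpace ℝ (Fin n) → ℝ)
    (g : ℝ → EuclideanSpace ℝ (Fin n) → EuclideanSpace ℝ (Fin n))
    (l : ℝ → EuclideanSpace ℝ (Fin n) → ℝ) : Prop where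
  cont : ContinuousOn (fun p : ℝ × EuclideanSpace ℝ (Fin n) => u p.1 p.2) (Icc 0 τ ×ˢ closure Ω)
  cont_grad : ContinuousOn (fun p : ℝ × EuclideanSpace ℝ (Fin n) => g p.1 p.2)
    (Icc 0 τ ×ˢ closure Ω)
  cont_lap : ContinuousOn (fun p : ℝ × EuclideanSpace ℝ (Fin n) => l p.1 p.2)
    (Icc 0 τ ×ˢ closure Ω)
  hasFDerivAt : ∀ s ∈ Icc 0 τ, ∀ z ∈ Ω, HasFDerivAt (u s) (innerSL ℝ (g s z)) z
  grad_contDiffOn : ∀ s ∈ Icc 0 τ, ContDiffOn ℝ 1 (g s) Ω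
  divg_grad : ∀ s ∈ Icc 0 τ, ∀ z ∈ Ω, divg (g s) z = l s z

lemma HasSpaceDerivs.weightedSum {ι : Type*} [Fintype ι] (hΩ : IsOpen Ω)
    {u : ι → ℝ → EuclideanSpace ℝ (Fin n) → ℝ}
    {g : ι → ℝ → EuclideanSpace ℝ (Fin n) → EuclideanSpace ℝ (Fin n)}
    {l : ι → ℝ → EuclideanSpace ℝ (Fin n) → ℝ} (h : ∀ i, HasSpaceDerivs Ω τ (u i) (g i) (l i))
    (κ : ι → ℝ) :
    HasSpaceDerivs Ω τ (fun s z => ∑ i, κ i * u i s z) (fun s z => ∑ i, κ i • g i s z)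
      (fun s z => ∑ i, κ i * l i s z) where
  cont := continuousOn_finsetSum _ fun i _ => (h i).cont.const_smul (κ i)
  cont_grad := continuousOn_finsetSum _ fun i _ => (h i).cont_grad.const_smul (κ i)
  cont_lap := continuousOn_finsetSum _ fun i _ => (h i).cont_lap.const_smul (κ i)
  hasFDerivAt s hs z hz := by
    have := HasFDerivAt.fun_sum (u := Finset.univ)
      fun i _ => ((h i).hasFDerivAt s hs z hz).const_mul (κ i)
    simpa using this
  grad_contDiffOn s hs := ContDiffOn.sum fun i _ =>
    ((h i).grad_contDiffOn s hs).const_smul (κ i)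
  divg_grad s hs z hz := by
    have hd : ∀ i, DifferentiableAt ℝ (g i s) z := fun i =>
      (((h i).grad_contDiffOn s hs).differentiableOn one_ne_zero).differentiableAt
        (hΩ.mem_nhds hz)
    rw [divg_sum (F := fun i x => κ i • g i s x) _ fun i _ => (hd i).const_smul (κ i)]
    refine Finset.sum_congr rfl fun i _ => ?_
    rw [← (h i).divg_grad s hs z hz, divg_smul (φ := fun _ => κ i) (by fun_prop) (hd i)]
    simp

/-- **Green's identity** for a finite family of test functions `φ i` with gradients `φ' i`, when the
boundary term vanishes. -/
lemma green_identity {ι : Type*} [Fintype ι] (hΩ : IsBoundedC2Domain Ω)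
    {u : ι → ℝ → EuclideanSpace ℝ (Fin n) → ℝ}
    {g : ι → ℝ → EuclideanSpace ℝ (Fin n) → EuclideanSpace ℝ (Fin n)}
    {l : ι → ℝ → EuclideanSpace ℝ (Fin n) → ℝ} (h : ∀ i, HasSpaceDerivs Ω τ (u i) (g i) (l i))
    {s : ℝ} (hs : s ∈ Icc 0 τ)
    {φ : ι → EuclideanSpace ℝ (Fin n) → ℝ}
    {φ' : ι → EuclideanSpace ℝ (Fin n) → EuclideanSpace ℝ (Fin n)}
    (hφ : ∀ i, ContinuousOn (φ i) (closure Ω)) (hφ' : ∀ i, ContinuousOn (φ' i) (closure Ω))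
    (hd : ∀ i, ∀ z ∈ Ω, HasFDerivAt (φ i) (innerSL ℝ (φ' i z)) z)
    (hbdry : ∀ z ∈ frontier Ω, ∀ ν, IsOuterUnitNormal Ω z ν →
      ∑ i, φ i z * ⟪g i s z, ν⟫_ℝ = 0) :
    ∫ z in Ω, ∑ i, (φ i z * l i s z + ⟪φ' i z, g i s z⟫_ℝ) = 0 := by
  have hφC : ∀ i, ContDiffOn ℝ 1 (φ i) Ω := fun i => by
    refine (contDiffOn_succ_iff_fderiv_of_isOpen (n := 0) hΩ.isOpen).2
      ⟨fun z hz => (hd i z hz).differentiableAt.differentiableWithinAt, by simp,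
        contDiffOn_zero.2 ?_⟩
    refine ContinuousOn.congr (f := fun z => innerSL ℝ (φ' i z)) ?_
      fun z hz => (hd i z hz).fderiv
    exact (innerSL ℝ).continuous.comp_continuousOn ((hφ' i).mono subset_closure)
  have hgd : ∀ i, ∀ z ∈ Ω, DifferentiableAt ℝ (g i s) z := fun i z hz =>
    (((h i).grad_contDiffOn s hs).differentiableOn one_ne_zero).differentiableAt
      (hΩ.isOpen.mem_nhds hz)
  have hdiv : ∀ z ∈ Ω, divg (fun x => ∑ i, φ i x • g i s x) z
      = ∑ i, (φ i z * l i s z + ⟪φ' i z, g i s z⟫_ℝ) := by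
    intro z hz
    rw [divg_sum (F := fun i x => φ i x • g i s x) _
      fun i _ => (hd i z hz).differentiableAt.smul (hgd i z hz)]
    refine Finset.sum_congr rfl fun i _ => ?_
    rw [divg_smul (hd i z hz).differentiableAt (hgd i z hz), (h i).divg_grad s hs z hz,
      (hd i z hz).fderiv]
    simp
  have hgc : ∀ i, ContinuousOn (g i s) (closure Ω) := fun i =>
    continuousOn_space_slice (h i).cont_grad hs
  have hlc : ∀ i, ContinuousOn (l i s) (closure Ω) := fun i =>
    continuousOn_space_slice (h i).cont_lap hs
  rw [← setIntegral_congr_fun hΩ.isOpen.measurableSet hdiv]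
  refine IsTangentialField.setIntegral_divg_eq_zero hΩ ⟨?_, ?_, ?_, ?_⟩
  · exact continuousOn_finsetSum _ fun i _ => (hφ i).smul (hgc i)
  · exact ContDiffOn.sum fun i _ => (hφC i).smul ((h i).grad_contDiffOn s hs)
  · refine IntegrableOn.congr_fun ?_ (fun z hz => (hdiv z hz).symm) hΩ.isOpen.measurableSet
    have hc : ContinuousOn (fun z => ∑ i, (φ i z * l i s z + ⟪φ' i z, g i s z⟫_ℝ)) (closure Ω) :=
      continuousOn_finsetSum _ fun i _ => ((hφ i).mul (hlc i)).add ((hφ' i).inner (hgc i))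
    exact (hc.integrableOn_compact hΩ.isCompact_closure).mono_set subset_closure
  · intro z hz ν hν
    rw [sum_inner]
    simpa [inner_smul_left] using hbdry z hz ν hν

end SpaceDerivatives

section ClassicalSolution

open Filter Topology InnerProductSpace

variable {n N m mS nS : ℕ} {Ω : Set (EuclideanSpace ℝ (Fin n))}

lemma Icc_subset_timeInterval {T : EReal} {τ : ℝ} (hτ : τ ∈ timeInterval T) :
    Icc 0 τ ⊆ timeInterval T := fun _ ht =>
  ⟨ht.1, (EReal.coe_le_coe_iff.2 ht.2).trans_lt hτ.2⟩

/-- The spatial gradient of the component `c_i` on `closure Ω`. -/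
def speciesGradient (Ω : Set (EuclideanSpace ℝ (Fin n)))
    (c : ℝ → EuclideanSpace ℝ (Fin n) → EuclideanSpace ℝ (Fin N)) (i : Fin N) (s : ℝ)
    (z : EuclideanSpace ℝ (Fin n)) : EuclideanSpace ℝ (Fin n) :=
  gradientWithin (fun x => c s x i) (closure Ω) z

/-- The spatial Laplacian of the component `c_i` on `closure Ω`. -/
def speciesLaplacian (Ω : Set (EuclideanSpace ℝ (Fin n)))
    (c : ℝ → EuclideanSpace ℝ (Fin n) → EuclideanSpace ℝ (Fin N)) (i : Fin N) (s : ℝ)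
    (z : EuclideanSpace ℝ (Fin n)) : ℝ :=
  laplacianWithin (fun x => c s x i) (closure Ω) z

lemma inner_speciesGradient (c : ℝ → EuclideanSpace ℝ (Fin n) → EuclideanSpace ℝ (Fin N))
    (i : Fin N) (s : ℝ) (z v : EuclideanSpace ℝ (Fin n)) :
    ⟪speciesGradient Ω c i s z, v⟫_ℝ = fderivWithin ℝ (fun x => c s x i) (closure Ω) z v :=
  inner_gradientWithin_left

lemma speciesGradient_eq_gradient (hΩ : IsOpen Ω)
    (c : ℝ → EuclideanSpace ℝ (Fin n) → EuclideanSpace ℝ (Fin N)) (i : Fin N) (s : ℝ)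
    {z : EuclideanSpace ℝ (Fin n)} (hz : z ∈ Ω) :
    speciesGradient Ω c i s z = ∇ (fun x => c s x i) z := by
  have h : closure Ω ∈ 𝓝 z := mem_of_superset (hΩ.mem_nhds hz) subset_closure
  rw [speciesGradient, gradientWithin, gradient, fderivWithin_of_mem_nhds h]

lemma inner_single_one (v : EuclideanSpace ℝ (Fin n)) (k : Fin n) :
    ⟪v, EuclideanSpace.single k (1 : ℝ)⟫_ℝ = v k := by
  rw [EuclideanSpace.inner_single_right]
  simp

lemma speciesLaplacian_eq_laplacian (hΩ : IsBoundedC2Domain Ω)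
    (c : ℝ → EuclideanSpace ℝ (Fin n) → EuclideanSpace ℝ (Fin N)) (i : Fin N) (s : ℝ)
    {z : EuclideanSpace ℝ (Fin n)} (hz : z ∈ Ω) :
    speciesLaplacian Ω c i s z = Laplacian.laplacian (fun x => c s x i) z := by
  have h : closure Ω =ᶠ[𝓝 z] univ :=
    eventuallyEq_univ.2 (mem_of_superset (hΩ.isOpen.mem_nhds hz) subset_closure)
  rw [speciesLaplacian, laplacianWithin_eq_iteratedFDerivWithin_stdOrthonormalBasis _
    hΩ.uniqueDiffOn_closure (subset_closure hz), laplacian_eq_iteratedFDeriv_stdOrthonormalBasis]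
  simp only [iteratedFDerivWithin_congr_set h, iteratedFDerivWithin_univ]

lemma divg_gradient {u : EuclideanSpace ℝ (Fin n) → ℝ} {z : EuclideanSpace ℝ (Fin n)}
    (hu : ContDiffAt ℝ 2 u z) : divg (∇ u) z = Laplacian.laplacian u z := by
  have hfd : DifferentiableAt ℝ (fderiv ℝ u) z :=
    (hu.fderiv_right (m := 1) (by norm_num)).differentiableAt one_ne_zero
  have hgd : DifferentiableAt ℝ (∇ u) z := by
    have : ∇ u = (toDual ℝ (EuclideanSpace ℝ (Fin n))).symm ∘ fderiv ℝ u := rfl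
    rw [this]
    exact ((toDual ℝ (EuclideanSpace ℝ (Fin n))).symm.toContinuousLinearEquiv
      |>.differentiableAt).comp z hfd
  rw [laplacian_eq_iteratedFDeriv_orthonormalBasis u (EuclideanSpace.basisFun (Fin n) ℝ)]
  simp only [divg]
  refine Finset.sum_congr rfl fun k _ => ?_
  rw [iteratedFDeriv_two_apply]
  have h1 : ∀ x, ∇ u x k = fderiv ℝ u x (EuclideanSpace.single k 1) := fun x => by
    rw [← inner_gradient_left, inner_single_one]
  have h2 := ((EuclideanSpace.proj k : EuclideanSpace ℝ (Fin n) →L[ℝ] ℝ).hasFDerivAt.comp z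
    hgd.hasFDerivAt).fderiv
  have h3 : (EuclideanSpace.proj k : EuclideanSpace ℝ (Fin n) →L[ℝ] ℝ) ∘ ∇ u
      = fun x => fderiv ℝ u x (EuclideanSpace.single k 1) := funext h1
  rw [h3] at h2
  have h4 := congrArg (fun L : EuclideanSpace ℝ (Fin n) →L[ℝ] ℝ =>
    L (EuclideanSpace.single k 1)) h2
  simp only [ContinuousLinearMap.comp_apply] at h4
  rw [fderiv_clm_apply hfd (by fun_prop)] at h4
  simpa using h4.symm

variable {T : EReal} {c : ℝ → EuclideanSpace ℝ (Fin n) → EuclideanSpace ℝ (Fin N)}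

lemma IsC12.continuousOn (h : IsC12 T Ω c) :
    ContinuousOn (fun p : ℝ × EuclideanSpace ℝ (Fin n) => c p.1 p.2)
      (timeInterval T ×ˢ closure Ω) := by
  have h0 := h.space_deriv_continuous 0 (by norm_num)
  have h1 := (ContinuousMultilinearMap.apply ℝ (fun _ : Fin 0 => EuclideanSpace ℝ (Fin n))
    (EuclideanSpace ℝ (Fin N)) 0).continuous.comp_continuousOn h0
  simpa [Function.comp_def] using h1

lemma IsC12.contDiffOn_species (h : IsC12 T Ω c) (i : Fin N) {s : ℝ} (hs : s ∈ timeInterval T) :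
    ContDiffOn ℝ 2 (fun x => c s x i) (closure Ω) :=
  (EuclideanSpace.proj i : EuclideanSpace ℝ (Fin N) →L[ℝ] ℝ).contDiff.comp_contDiffOn
    (h.space_contDiff s hs)

lemma IsC12.hasSpaceDerivs (hΩ : IsBoundedC2Domain Ω) (h : IsC12 T Ω c) {τ : ℝ}
    (hτ : τ ∈ timeInterval T) (i : Fin N) :
    HasSpaceDerivs Ω τ (fun s z => c s z i) (speciesGradient Ω c i) (speciesLaplacian Ω c i) := by
  have hI := Icc_subset_timeInterval hτ
  have hud := hΩ.uniqueDiffOn_closure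
  have hIK : Icc 0 τ ×ˢ closure Ω ⊆ timeInterval T ×ˢ closure Ω :=
    prod_mono hI subset_rfl
  have hnhds : ∀ z ∈ Ω, closure Ω ∈ 𝓝 z := fun z hz =>
    mem_of_superset (hΩ.isOpen.mem_nhds hz) subset_closure
  have hCD : ∀ s ∈ Icc 0 τ, ∀ z ∈ Ω, ContDiffAt ℝ 2 (fun x => c s x i) z := fun s hs z hz =>
    (h.contDiffOn_species i (hI hs)).contDiffAt (hnhds z hz)
  set π : EuclideanSpace ℝ (Fin N) →L[ℝ] ℝ := EuclideanSpace.proj i with hπ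
  refine ⟨?_, ?_, ?_, ?_, ?_, ?_⟩
  · exact π.continuous.comp_continuousOn (h.continuousOn.mono hIK)
  · have h1 := (h.space_deriv_continuous 1 (by norm_num)).mono hIK
    have hk : ∀ k, ContinuousOn (fun p : ℝ × EuclideanSpace ℝ (Fin n) =>
        speciesGradient Ω c i p.1 p.2 k) (Icc 0 τ ×ˢ closure Ω) := by
      intro k
      have h2 := π.continuous.comp_continuousOn
        ((ContinuousMultilinearMap.apply ℝ (fun _ : Fin 1 => EuclideanSpace ℝ (Fin n))
          (EuclideanSpace ℝ (Fin N))
          fun _ => EuclideanSpace.single k 1).continuous.comp_continuousOn h1)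
      refine h2.congr ?_
      rintro ⟨s, z⟩ ⟨hs, hz⟩
      have h3 : DifferentiableWithinAt ℝ (c s) (closure Ω) z :=
        (h.space_contDiff s (hI hs)).differentiableOn two_ne_zero z hz
      have h4 : fderivWithin ℝ (fun x => c s x i) (closure Ω) z
          = π ∘L fderivWithin ℝ (c s) (closure Ω) z :=
        (π.hasFDerivAt.comp_hasFDerivWithinAt z h3.hasFDerivWithinAt).fderivWithin (hud z hz)
      have h5 : speciesGradient Ω c i s z k
          = ⟪speciesGradient Ω c i s z, EuclideanSpace.single k 1⟫_ℝ :=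
        (inner_single_one _ _).symm
      simp only [Function.comp_apply, ContinuousMultilinearMap.apply_apply]
      rw [h5, inner_speciesGradient, h4, iteratedFDerivWithin_one_apply (hud z hz)]
      rfl
    have := (PiLp.continuous_toLp 2 (fun _ : Fin n => ℝ)).comp_continuousOn
      (continuousOn_pi.2 hk)
    exact this
  · have h1 := (h.space_deriv_continuous 2 le_rfl).mono hIK
    have h2 : ∀ k : Fin n, ContinuousOn (fun p : ℝ × EuclideanSpace ℝ (Fin n) =>
        π (iteratedFDerivWithin ℝ 2 (c p.1) (closure Ω) p.2
          ![EuclideanSpace.basisFun (Fin n) ℝ k, EuclideanSpace.basisFun (Fin n) ℝ k]))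
        (Icc 0 τ ×ˢ closure Ω) := fun k =>
      π.continuous.comp_continuousOn
        ((ContinuousMultilinearMap.apply ℝ (fun _ : Fin 2 => EuclideanSpace ℝ (Fin n))
          (EuclideanSpace ℝ (Fin N)) _).continuous.comp_continuousOn h1)
    refine (continuousOn_finsetSum Finset.univ fun k _ => h2 k).congr ?_
    rintro ⟨s, z⟩ ⟨hs, hz⟩
    have h3 := ContDiffWithinAt.laplacianWithin_CLM_comp_left (l := π)
      (h.space_contDiff s (hI hs) z hz) hud hz
    rw [Function.comp_apply, laplacianWithin_eq_iteratedFDerivWithin_orthonormalBasis (c s) hud hz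
      (EuclideanSpace.basisFun (Fin n) ℝ), map_sum] at h3
    exact h3
  · intro s hs z hz
    have h1 := ((hCD s hs z hz).differentiableAt two_ne_zero).hasFDerivAt
    refine h1.congr_fderiv ?_
    ext v
    rw [innerSL_apply_apply, inner_speciesGradient, fderivWithin_of_mem_nhds (hnhds z hz)]
  · intro s hs
    have h1 : ContDiffOn ℝ 2 (fun x => c s x i) Ω :=
      (h.contDiffOn_species i (hI hs)).mono subset_closure
    have h2 : ContDiffOn ℝ 1 (fderiv ℝ (fun x => c s x i)) Ω :=
      h1.fderiv_of_isOpen hΩ.isOpen (by norm_num)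
    refine ContDiffOn.congr (f := fun z => ∇ (fun x => c s x i) z) ?_
      fun z hz => speciesGradient_eq_gradient hΩ.isOpen c i s hz
    exact ((toDual ℝ (EuclideanSpace ℝ (Fin n))).symm.toContinuousLinearEquiv.contDiff
      (n := 1)).comp_contDiffOn h2
  · intro s hs z hz
    have h1 : speciesGradient Ω c i s =ᶠ[𝓝 z] ∇ (fun x => c s x i) := by
      filter_upwards [hΩ.isOpen.mem_nhds hz] with y hy
      exact speciesGradient_eq_gradient hΩ.isOpen c i s hy
    rw [divg_congr h1, divg_gradient (hCD s hs z hz), speciesLaplacian_eq_laplacian hΩ c i s hz]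

end ClassicalSolution

/-! ### Bounds for a conserved density -/

section ConservedDensity

open Filter Topology

variable {n : ℕ} {Ω : Set (EuclideanSpace ℝ (Fin n))} {τ D M : ℝ}

/-- A density `w` with `∂ₜ w = Δ a` in `Ω` and `∂ₙ a = 0` on the boundary, where `ga` and `la` are
the gradient and the Laplacian of `a`, and `0 ≤ a ≤ D w`, `w(0) ≤ M`. -/
structure IsConservedDensity (Ω : Set (EuclideanSpace ℝ (Fin n))) (τ D M : ℝ)
    (w a : ℝ → EuclideanSpace ℝ (Fin n) → ℝ)
    (ga : ℝ → EuclideanSpace ℝ (Fin n) → EuclideanSpace ℝ (Fin n))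
    (la : ℝ → EuclideanSpace ℝ (Fin n) → ℝ) : Prop where
  cont : ContinuousOn (fun p : ℝ × EuclideanSpace ℝ (Fin n) => w p.1 p.2) (Icc 0 τ ×ˢ closure Ω)
  deriv : ∀ z ∈ Ω, ∀ s ∈ Icc 0 τ, HasDerivWithinAt (fun r => w r z) (la s z) (Icc 0 τ) s
  flux : HasSpaceDerivs Ω τ a ga la
  noFlux : ∀ s ∈ Icc 0 τ, ∀ z ∈ frontier Ω, ∀ ν, IsOuterUnitNormal Ω z ν → ⟪ga s z, ν⟫_ℝ = 0
  nonneg : ∀ s ∈ Icc 0 τ, ∀ z ∈ closure Ω, 0 ≤ a s z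
  le_mul : ∀ s ∈ Icc 0 τ, ∀ z ∈ closure Ω, a s z ≤ D * w s z
  initial_le : ∀ z ∈ closure Ω, w 0 z ≤ M

variable {w a : ℝ → EuclideanSpace ℝ (Fin n) → ℝ}
  {ga : ℝ → EuclideanSpace ℝ (Fin n) → EuclideanSpace ℝ (Fin n)}
  {la : ℝ → EuclideanSpace ℝ (Fin n) → ℝ}

lemma IsConservedDensity.setIntegral_eq (hΩ : IsBoundedC2Domain Ω)
    (h : IsConservedDensity Ω τ D M w a ga la) {t : ℝ} (ht : t ∈ Icc 0 τ) :
    ∫ z in Ω, w t z = ∫ z in Ω, w 0 z := by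
  rw [setIntegral_sub_eq_intervalIntegral hΩ.isOpen hΩ.isCompact_closure h.cont h.flux.cont_lap
    h.deriv ht, add_eq_left]
  refine intervalIntegral.integral_zero_ae (Eventually.of_forall fun s hs => ?_)
  rw [uIoc_of_le ht.1] at hs
  have hs' : s ∈ Icc 0 τ := ⟨hs.1.le, hs.2.trans ht.2⟩
  have := green_identity (ι := Unit) hΩ (fun _ => h.flux) hs' (φ := fun _ _ => 1)
    (φ' := fun _ _ => 0) (fun _ => continuousOn_const) (fun _ => continuousOn_const)
    (fun _ z _ => by simpa using hasFDerivAt_const (1 : ℝ) z)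
    (fun z hz ν hν => by simpa using h.noFlux s hs' z hz ν hν)
  simpa using this

lemma IsConservedDensity.sub_initial (h : IsConservedDensity Ω τ D M w a ga la)
    {t : ℝ} (ht : t ∈ Icc 0 τ)
    {z : EuclideanSpace ℝ (Fin n)} (hz : z ∈ Ω) :
    ∫ s in (0 : ℝ)..t, la s z = w t z - w 0 z := by
  refine intervalIntegral.integral_eq_sub_of_hasDerivAt_of_le (f := fun r => w r z) ht.1
    ((continuousOn_time_slice h.cont (subset_closure hz)).mono (Icc_subset_Icc_right ht.2))
    (fun s hs => ?_) (intervalIntegrable_time_slice h.flux.cont_lap (subset_closure hz) ht)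
  exact (h.deriv z hz s ⟨hs.1.le, hs.2.le.trans ht.2⟩).hasDerivAt
    (Icc_mem_nhds hs.1 (hs.2.trans_le ht.2))

/-- Weak form of `Δ ∫₀ᵗ a = w(t) - w(0)` with zero Neumann data. -/
lemma IsConservedDensity.weak_form (hΩ : IsBoundedC2Domain Ω)
    (h : IsConservedDensity Ω τ D M w a ga la) {t : ℝ} (ht : t ∈ Icc 0 τ)
    {φ : EuclideanSpace ℝ (Fin n) → ℝ}
    {φ' : EuclideanSpace ℝ (Fin n) → EuclideanSpace ℝ (Fin n)}
    (hφ : ContinuousOn φ (closure Ω)) (hφ' : ContinuousOn φ' (closure Ω))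
    (hd : ∀ z ∈ Ω, HasFDerivAt φ (innerSL ℝ (φ' z)) z) :
    ∫ z in Ω, (φ z * (w t z - w 0 z) + ⟪φ' z, ∫ s in (0 : ℝ)..t, ga s z⟫_ℝ) = 0 := by
  have hsnd : MapsTo (fun p : ℝ × EuclideanSpace ℝ (Fin n) => p.2)
      (Icc 0 τ ×ˢ closure Ω) (closure Ω) := fun p hp => hp.2
  have hc1 : ContinuousOn (fun p : ℝ × EuclideanSpace ℝ (Fin n) => φ p.2 * la p.1 p.2)
      (Icc 0 τ ×ˢ closure Ω) := (hφ.comp continuousOn_snd hsnd).mul h.flux.cont_lap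
  have hc2 : ContinuousOn (fun p : ℝ × EuclideanSpace ℝ (Fin n) => ⟪φ' p.2, ga p.1 p.2⟫_ℝ)
      (Icc 0 τ ×ˢ closure Ω) := (hφ'.comp continuousOn_snd hsnd).inner h.flux.cont_grad
  have hcont : ContinuousOn (fun p : ℝ × EuclideanSpace ℝ (Fin n) =>
      φ p.2 * la p.1 p.2 + ⟪φ' p.2, ga p.1 p.2⟫_ℝ) (Icc 0 τ ×ˢ closure Ω) := hc1.add hc2
  have hpt : ∀ z ∈ Ω, φ z * (w t z - w 0 z) + ⟪φ' z, ∫ s in (0 : ℝ)..t, ga s z⟫_ℝ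
      = ∫ s in (0 : ℝ)..t, (φ z * la s z + ⟪φ' z, ga s z⟫_ℝ) := by
    intro z hz
    have hzc := subset_closure hz
    have e1 : ⟪φ' z, ∫ s in (0 : ℝ)..t, ga s z⟫_ℝ
        = ∫ s in (0 : ℝ)..t, ⟪φ' z, ga s z⟫_ℝ :=
      (ContinuousLinearMap.intervalIntegral_comp_comm (innerSL ℝ (φ' z))
        (intervalIntegrable_time_slice h.flux.cont_grad hzc ht)).symm
    rw [intervalIntegral.integral_add
      (intervalIntegrable_time_slice (f := fun s z => φ z * la s z) hc1 hzc ht)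
      (intervalIntegrable_time_slice (f := fun s z => ⟪φ' z, ga s z⟫_ℝ) hc2 hzc ht),
      intervalIntegral.integral_const_mul, h.sub_initial ht hz, e1]
  rw [setIntegral_congr_fun hΩ.isOpen.measurableSet hpt,
    ← intervalIntegral_setIntegral_swap (f := fun s z => φ z * la s z + ⟪φ' z, ga s z⟫_ℝ)
      hΩ.isCompact_closure hcont ht]
  refine intervalIntegral.integral_zero_ae (Eventually.of_forall fun s hs => ?_)
  rw [uIoc_of_le ht.1] at hs
  have hs' : s ∈ Icc 0 τ := ⟨hs.1.le, hs.2.trans ht.2⟩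
  have := green_identity (ι := Unit) hΩ (fun _ => h.flux) hs' (φ := fun _ => φ)
    (φ' := fun _ => φ') (fun _ => hφ) (fun _ => hφ') (fun _ => hd)
    (fun z hz ν hν => by simp [h.noFlux s hs' z hz ν hν])
  simpa using this

lemma hasDerivAt_max_zero_pow (k : ℕ) (x : ℝ) :
    HasDerivAt (fun y : ℝ => max y 0 ^ (k + 2)) ((k + 2 : ℝ) * max x 0 ^ (k + 1)) x := by
  rcases lt_trichotomy x 0 with hx | rfl | hx
  · rw [max_eq_right hx.le]
    have h : (fun y : ℝ => max y 0 ^ (k + 2)) =ᶠ[𝓝 x] fun _ => 0 := by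
      filter_upwards [Iio_mem_nhds hx] with y hy
      rw [max_eq_right (le_of_lt hy)]
      simp
    simpa using (hasDerivAt_const x (0 : ℝ)).congr_of_eventuallyEq h
  · have h : (fun y : ℝ => max y 0 ^ (k + 2)) =O[𝓝 0] fun y => ‖y - 0‖ ^ (k + 2) := by
      refine Asymptotics.isBigO_of_le _ fun y => ?_
      rw [norm_pow, norm_pow, norm_norm, sub_zero]
      refine pow_le_pow_left₀ (norm_nonneg _) ?_ _
      rw [Real.norm_of_nonneg (le_max_right _ _)]
      exact max_le (le_abs_self y) (abs_nonneg y)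
    have h2 : HasFDerivAt (fun y : ℝ => max y 0 ^ (k + 2)) (0 : ℝ →L[ℝ] ℝ) 0 :=
      h.hasFDerivAt (by omega)
    rw [hasDerivAt_iff_hasFDerivAt]
    refine h2.congr_fderiv ?_
    ext
    simp
  · rw [max_eq_left hx.le]
    have h : (fun y : ℝ => max y 0 ^ (k + 2)) =ᶠ[𝓝 x] fun y => y ^ (k + 2) := by
      filter_upwards [Ioi_mem_nhds hx] with y hy
      rw [max_eq_left (le_of_lt hy)]
    refine ((hasDerivAt_pow (k + 2) x).congr_of_eventuallyEq h).congr_deriv ?_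
    push_cast
    rfl

/-- Comparison principle: `W = ∫₀ᵗ a` satisfies `∂ₜ W ≤ D ΔW + D M` with zero Neumann data, hence
`W ≤ D M t`. The proof is an energy estimate for the cube of the positive part of `W - D M t`; the
cube makes the test function `((W - D M t)⁺)²` continuously differentiable. -/
lemma IsConservedDensity.time_primitive_le (hΩ : IsBoundedC2Domain Ω)
    (h : IsConservedDensity Ω τ D M w a ga la) (hD : 0 ≤ D) {t : ℝ} (ht : t ∈ Icc 0 τ)
    {z : EuclideanSpace ℝ (Fin n)} (hz : z ∈ closure Ω) :
    ∫ s in (0 : ℝ)..t, a s z ≤ D * M * t := by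
  have hτ : 0 ≤ τ := ht.1.trans ht.2
  have hK := hΩ.isCompact_closure
  set V : ℝ → EuclideanSpace ℝ (Fin n) → ℝ :=
    fun r x => (∫ s in (0 : ℝ)..r, a s x) - D * M * r with hV
  set P : ℝ → EuclideanSpace ℝ (Fin n) → EuclideanSpace ℝ (Fin n) :=
    fun r x => ∫ s in (0 : ℝ)..r, ga s x with hP
  have hVc : ContinuousOn (fun p : ℝ × EuclideanSpace ℝ (Fin n) => V p.1 p.2)
      (Icc 0 τ ×ˢ closure Ω) :=
    (continuousOn_time_primitive hτ h.flux.cont).sub (by fun_prop)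
  have hPc : ContinuousOn (fun p : ℝ × EuclideanSpace ℝ (Fin n) => P p.1 p.2)
      (Icc 0 τ ×ˢ closure Ω) := continuousOn_time_primitive hτ h.flux.cont_grad
  have hVp : ∀ k : ℕ, ContinuousOn
      (fun p : ℝ × EuclideanSpace ℝ (Fin n) => max (V p.1 p.2) 0 ^ k)
      (Icc 0 τ ×ˢ closure Ω) := fun k => (hVc.sup continuousOn_const).pow k
  have hVt : ∀ x ∈ Ω, ∀ s ∈ Icc 0 τ,
      HasDerivWithinAt (fun r => V r x) (a s x - D * M) (Icc 0 τ) s := fun x hx s hs => by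
    have h1 := hasDerivWithinAt_time_primitive
      (continuousOn_time_slice h.flux.cont (subset_closure hx)) hs
    have h2 := ((hasDerivAt_id s).const_mul (D * M)).hasDerivWithinAt (s := Icc 0 τ)
    exact (h1.sub h2).congr_deriv (by simp)
  have hVx : ∀ s ∈ Icc 0 τ, ∀ x ∈ Ω, HasFDerivAt (V s) (innerSL ℝ (P s x)) x := fun s hs x hx =>
    (hasFDerivAt_time_primitive hΩ.isOpen hK h.flux.cont h.flux.cont_grad h.flux.hasFDerivAt
      hs hx).sub_const _
  -- the energy inequality at a fixed time
  have henergy : ∀ s ∈ Icc 0 τ,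
      ∫ x in Ω, 3 * max (V s x) 0 ^ 2 * (a s x - D * M) ≤ 0 := by
    intro s hs
    have hw0 := continuousOn_space_slice h.cont ⟨le_rfl, hτ⟩
    have hws := continuousOn_space_slice h.cont hs
    have has := continuousOn_space_slice h.flux.cont hs
    have hPs := continuousOn_space_slice hPc hs
    have hVs : ∀ k : ℕ, ContinuousOn (fun x => max (V s x) 0 ^ k) (closure Ω) := fun k =>
      continuousOn_space_slice (f := fun s x => max (V s x) 0 ^ k) (hVp k) hs
    have hφ' : ContinuousOn (fun x => (2 * max (V s x) 0 ^ 1) • P s x) (closure Ω) :=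
      (continuousOn_const.mul (hVs 1)).smul hPs
    have hweak := h.weak_form hΩ hs (hVs 2) hφ' (fun x hx => by
      have h1 := (hasDerivAt_max_zero_pow 0 (V s x)).comp_hasFDerivAt x (hVx s hs x hx)
      refine h1.congr_fderiv ?_
      ext v
      simp)
    have hle : ∀ x ∈ Ω, 3 * max (V s x) 0 ^ 2 * (a s x - D * M)
        ≤ 3 * D * (max (V s x) 0 ^ 2 * (w s x - w 0 x)
          + ⟪(2 * max (V s x) 0 ^ 1) • P s x, P s x⟫_ℝ) := by
      intro x hx
      have hxc := subset_closure hx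
      have h1 : a s x - D * M ≤ D * (w s x - w 0 x) := by
        have := h.le_mul s hs x hxc
        have := mul_le_mul_of_nonneg_left (h.initial_le x hxc) hD
        linarith
      have h2 : 0 ≤ ⟪(2 * max (V s x) 0 ^ 1) • P s x, P s x⟫_ℝ := by
        rw [real_inner_smul_left, real_inner_self_eq_norm_sq]
        have := le_max_right (V s x) 0
        positivity
      have h3 : 3 * max (V s x) 0 ^ 2 * (a s x - D * M)
          ≤ 3 * max (V s x) 0 ^ 2 * (D * (w s x - w 0 x)) :=
        mul_le_mul_of_nonneg_left h1 (by positivity)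
      have h4 := mul_nonneg (mul_nonneg (by norm_num : (0 : ℝ) ≤ 3) hD) h2
      linarith
    have hint : ∀ {f : EuclideanSpace ℝ (Fin n) → ℝ}, ContinuousOn f (closure Ω) →
        IntegrableOn f Ω := fun hf => (hf.integrableOn_compact hK).mono_set subset_closure
    have hmono : ∫ x in Ω, 3 * max (V s x) 0 ^ 2 * (a s x - D * M)
        ≤ ∫ x in Ω, 3 * D * (max (V s x) 0 ^ 2 * (w s x - w 0 x)
          + ⟪(2 * max (V s x) 0 ^ 1) • P s x, P s x⟫_ℝ) := setIntegral_mono_on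
      (hint ((continuousOn_const.mul (hVs 2)).mul (has.sub continuousOn_const)))
      (hint (continuousOn_const.mul (((hVs 2).mul (hws.sub hw0)).add (hφ'.inner hPs))))
      hΩ.isOpen.measurableSet hle
    rw [integral_const_mul, hweak, mul_zero] at hmono
    exact hmono
  have hcube : ∫ x in Ω, max (V t x) 0 ^ 3 ≤ 0 := by
    rw [setIntegral_sub_eq_intervalIntegral (f := fun s x => max (V s x) 0 ^ 3)
      (f' := fun s x => 3 * max (V s x) 0 ^ 2 * (a s x - D * M)) hΩ.isOpen hK (hVp 3)
      ((continuousOn_const.mul (hVp 2)).mul (h.flux.cont.sub continuousOn_const))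
      (fun x hx s hs => ?_) ht]
    · have h0 : ∫ x in Ω, max (V 0 x) 0 ^ 3 = 0 := by simp [hV]
      rw [h0, zero_add, ← neg_nonneg, ← intervalIntegral.integral_neg]
      exact intervalIntegral.integral_nonneg ht.1 fun s hs =>
        neg_nonneg.2 (henergy s ⟨hs.1, hs.2.trans ht.2⟩)
    · have h1 := (hasDerivAt_max_zero_pow 1 (V s x)).comp_hasDerivWithinAt s (hVt x hx s hs)
      refine h1.congr_deriv ?_
      norm_num
  have hc3 : ContinuousOn (fun x => max (V t x) 0 ^ 3) (closure Ω) :=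
    continuousOn_space_slice (f := fun s x => max (V s x) 0 ^ 3) (hVp 3) ht
  have hnn : ∀ x, 0 ≤ max (V t x) 0 ^ 3 := fun x => pow_nonneg (le_max_right _ _) _
  have hzero : ∫ x in Ω, max (V t x) 0 ^ 3 = 0 := le_antisymm hcube (integral_nonneg hnn)
  have hae := (integral_eq_zero_iff_of_nonneg hnn
    ((hc3.integrableOn_compact hK).mono_set subset_closure)).1 hzero
  have heq := Measure.eqOn_open_of_ae_eq (μ := volume) hae hΩ.isOpen (hc3.mono subset_closure)
    continuousOn_const
  have hVneg : ∀ x ∈ Ω, V t x ≤ 0 := fun x hx => by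
    have h1 : max (V t x) 0 ^ 3 = 0 := heq hx
    have h2 := eq_zero_of_pow_eq_zero h1
    exact (le_max_left _ _).trans h2.le
  have := le_on_closure hVneg (continuousOn_space_slice hVc ht) continuousOn_const hz
  simp only [hV] at this
  linarith

/-- Testing `Δ ∫₀ᵗ a = w(t) - w(0)` with `a = ∂ₜ ∫₀ᵗ a` and integrating in time leaves
`½ ∫ |∇ ∫₀ᵗ a|² ≥ 0`, so the space-time integral of `a (w - w(0))` is not positive. -/
lemma IsConservedDensity.intervalIntegral_mul_sub_nonpos (hΩ : IsBoundedC2Domain Ω)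
    (h : IsConservedDensity Ω τ D M w a ga la) {t : ℝ} (ht : t ∈ Icc 0 τ) :
    ∫ s in (0 : ℝ)..t, ∫ z in Ω, a s z * (w s z - w 0 z) ≤ 0 := by
  have hτ : 0 ≤ τ := ht.1.trans ht.2
  have hK := hΩ.isCompact_closure
  set P : ℝ → EuclideanSpace ℝ (Fin n) → EuclideanSpace ℝ (Fin n) :=
    fun r x => ∫ s in (0 : ℝ)..r, ga s x with hP
  have hPc : ContinuousOn (fun p : ℝ × EuclideanSpace ℝ (Fin n) => P p.1 p.2)
      (Icc 0 τ ×ˢ closure Ω) := continuousOn_time_primitive hτ h.flux.cont_grad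
  have hPga : ContinuousOn (fun p : ℝ × EuclideanSpace ℝ (Fin n) => ⟪P p.1 p.2, ga p.1 p.2⟫_ℝ)
      (Icc 0 τ ×ˢ closure Ω) := hPc.inner h.flux.cont_grad
  have hPP : ContinuousOn (fun p : ℝ × EuclideanSpace ℝ (Fin n) => ⟪P p.1 p.2, P p.1 p.2⟫_ℝ)
      (Icc 0 τ ×ˢ closure Ω) := hPc.inner hPc
  have hftc := setIntegral_sub_eq_intervalIntegral (f := fun s x => ⟪P s x, P s x⟫_ℝ)
    (f' := fun s x => 2 * ⟪P s x, ga s x⟫_ℝ) hΩ.isOpen hK hPP (continuousOn_const.mul hPga)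
    (fun x hx s hs => by
      have h1 := hasDerivWithinAt_time_primitive
        (continuousOn_time_slice h.flux.cont_grad (subset_closure hx)) hs
      refine (h1.inner ℝ h1).congr_deriv ?_
      rw [real_inner_comm (P s x) (ga s x)]
      ring) ht
  have h0 : ∫ x in Ω, ⟪P 0 x, P 0 x⟫_ℝ = 0 := by simp [hP]
  have hnn : 0 ≤ ∫ x in Ω, ⟪P t x, P t x⟫_ℝ := integral_nonneg fun x => real_inner_self_nonneg
  have hweak : ∀ s ∈ Icc 0 τ, ∫ z in Ω, 2 * ⟪P s z, ga s z⟫_ℝ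
      = -2 * ∫ z in Ω, a s z * (w s z - w 0 z) := by
    intro s hs
    have has := continuousOn_space_slice h.flux.cont hs
    have hws := continuousOn_space_slice h.cont hs
    have hw0 := continuousOn_space_slice h.cont ⟨le_rfl, hτ⟩
    have hgs := continuousOn_space_slice h.flux.cont_grad hs
    have hPs := continuousOn_space_slice hPc hs
    have h1 := h.weak_form hΩ hs has hgs (fun z hz => h.flux.hasFDerivAt s hs z hz)
    have h2 : ∫ z in Ω, (a s z * (w s z - w 0 z) + ⟪ga s z, P s z⟫_ℝ)
        = (∫ z in Ω, a s z * (w s z - w 0 z)) + ∫ z in Ω, ⟪ga s z, P s z⟫_ℝ :=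
      integral_add (((has.mul (hws.sub hw0)).integrableOn_compact hK).mono_set subset_closure)
        (((hgs.inner hPs).integrableOn_compact hK).mono_set subset_closure)
    have h3 : ∫ z in Ω, ⟪P s z, ga s z⟫_ℝ = ∫ z in Ω, ⟪ga s z, P s z⟫_ℝ :=
      integral_congr_ae (Eventually.of_forall fun z => real_inner_comm _ _)
    rw [integral_const_mul, h3]
    linarith [h2.symm.trans h1]
  rw [h0, zero_add, intervalIntegral.integral_congr (g := fun s =>
    -2 * ∫ z in Ω, a s z * (w s z - w 0 z)) (fun s hs => ?_),
    intervalIntegral.integral_const_mul] at hftc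
  · linarith
  · rw [uIcc_of_le ht.1] at hs
    exact hweak s ⟨hs.1, hs.2.trans ht.2⟩

lemma IsConservedDensity.intervalIntegral_mul_le (hΩ : IsBoundedC2Domain Ω)
    (h : IsConservedDensity Ω τ D M w a ga la) (hD : 0 ≤ D) (hM : 0 ≤ M) {t : ℝ}
    (ht : t ∈ Icc 0 τ) :
    ∫ s in (0 : ℝ)..t, ∫ z in Ω, w s z * a s z ≤ M * (D * M * t * volume.real Ω) := by
  have hτ : 0 ≤ τ := ht.1.trans ht.2
  have hK := hΩ.isCompact_closure
  have h0 : (0 : ℝ) ∈ Icc 0 τ := ⟨le_rfl, hτ⟩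
  have hw0 : ContinuousOn (fun p : ℝ × EuclideanSpace ℝ (Fin n) => w 0 p.2)
      (Icc 0 τ ×ˢ closure Ω) :=
    (continuousOn_space_slice h.cont h0).comp continuousOn_snd fun p hp => hp.2
  have hc1 := h.flux.cont.mul (h.cont.sub hw0)
  have hc2 := h.flux.cont
  have hprim : ∫ s in (0 : ℝ)..t, ∫ z in Ω, a s z ≤ D * M * t * volume.real Ω := by
    rw [intervalIntegral_setIntegral_swap hK hc2 ht]
    have hfin : volume Ω ≠ ⊤ := hΩ.isBounded.measure_lt_top.ne
    calc ∫ z in Ω, ∫ s in (0 : ℝ)..t, a s z ≤ ∫ z in Ω, D * M * t := by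
          refine setIntegral_mono_on ?_ (integrableOn_const hfin) hΩ.isOpen.measurableSet
            fun z hz => h.time_primitive_le hΩ hD ht (subset_closure hz)
          exact integrableOn_space_slice (f := fun r z => ∫ s in (0 : ℝ)..r, a s z) hK
            (continuousOn_time_primitive hτ hc2) ht
      _ = D * M * t * volume.real Ω := by
          rw [setIntegral_const, smul_eq_mul, mul_comm]
  have hle : ∫ s in (0 : ℝ)..t, ∫ z in Ω, w s z * a s z
      ≤ ∫ s in (0 : ℝ)..t, ((∫ z in Ω, a s z * (w s z - w 0 z)) + M * ∫ z in Ω, a s z) := by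
    refine intervalIntegral.integral_mono_on ht.1
      (intervalIntegrable_setIntegral (f := fun s z => w s z * a s z) hK (h.cont.mul hc2) ht)
      ((intervalIntegrable_setIntegral (f := fun s z => a s z * (w s z - w 0 z)) hK hc1 ht).add
        ((intervalIntegrable_setIntegral hK hc2 ht).const_mul M)) fun s hs => ?_
    have hs' : s ∈ Icc 0 τ := ⟨hs.1, hs.2.trans ht.2⟩
    rw [← integral_const_mul, ← integral_add
      (integrableOn_space_slice (f := fun s z => a s z * (w s z - w 0 z)) hK hc1 hs')
      ((integrableOn_space_slice hK hc2 hs').const_mul M)]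
    refine setIntegral_mono_on
      (integrableOn_space_slice (f := fun s z => w s z * a s z) hK (h.cont.mul hc2) hs')
      ((integrableOn_space_slice (f := fun s z => a s z * (w s z - w 0 z)) hK hc1 hs').add
        ((integrableOn_space_slice hK hc2 hs').const_mul M))
      hΩ.isOpen.measurableSet fun z hz => ?_
    have h1 := mul_nonneg (h.nonneg s hs' z (subset_closure hz))
      (sub_nonneg.2 (h.initial_le z (subset_closure hz)))
    nlinarith
  rw [intervalIntegral.integral_add
    (intervalIntegrable_setIntegral (f := fun s z => a s z * (w s z - w 0 z)) hK hc1 ht)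
    ((intervalIntegrable_setIntegral hK hc2 ht).const_mul M),
    intervalIntegral.integral_const_mul] at hle
  have h1 := h.intervalIntegral_mul_sub_nonpos hΩ ht
  have h2 := mul_le_mul_of_nonneg_left hprim hM
  linarith

end ConservedDensity

/-! ### Conserved density and entropy of a classical solution -/

namespace CatalysisSystem

section Estimates

open Filter Topology

variable {n N m mS nS : ℕ} {Ω : Set (EuclideanSpace ℝ (Fin n))} {S : CatalysisSystem N m mS nS}
  {T : EReal} {τ : ℝ} {c0 : EuclideanSpace ℝ (Fin n) → EuclideanSpace ℝ (Fin N)}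
  {c : ℝ → EuclideanSpace ℝ (Fin n) → EuclideanSpace ℝ (Fin N)}

lemma IsClassicalSolution.hasDerivWithinAt (hΩ : IsBoundedC2Domain Ω)
    (hc : S.IsClassicalSolution Ω T c0 c) (hτ : τ ∈ timeInterval T) (i : Fin N)
    {z : EuclideanSpace ℝ (Fin n)} (hz : z ∈ Ω) {s : ℝ} (hs : s ∈ Icc 0 τ) :
    HasDerivWithinAt (fun r => c r z i) (S.d i * speciesLaplacian Ω c i s z + S.rate (c s z) i)
      (Icc 0 τ) s := by
  have hI := Icc_subset_timeInterval hτ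
  have h1 := hc.regular.time_differentiable z (subset_closure hz) s (hI hs)
  have hπ : DifferentiableAt ℝ (fun v : EuclideanSpace ℝ (Fin N) => v i) (c s z) :=
    (EuclideanSpace.proj i : EuclideanSpace ℝ (Fin N) →L[ℝ] ℝ).differentiableAt
  have h2 : DifferentiableWithinAt ℝ (fun r => c r z i) (timeInterval T) s :=
    DifferentiableAt.comp_differentiableWithinAt (f := fun r => c r z)
      (g := fun v : EuclideanSpace ℝ (Fin N) => v i) s hπ h1
  refine (h2.hasDerivWithinAt.mono hI).congr_deriv ?_
  rw [← sub_eq_iff_eq_add', speciesLaplacian_eq_laplacian hΩ c i s hz]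
  exact hc.bulk s (hI hs) z hz i

/-- Any `ξ` orthogonal to the surface stoichiometric vectors is a combination of the vectors `eS k`,
so the `ξ`-component of the diffusive boundary flux vanishes. -/
lemma IsClassicalSolution.sum_flux_eq_zero (hc : S.IsClassicalSolution Ω T c0 c) {s : ℝ}
    (hs : s ∈ timeInterval T) {z : EuclideanSpace ℝ (Fin n)} (hz : z ∈ frontier Ω)
    {ν : EuclideanSpace ℝ (Fin n)} (hν : IsOuterUnitNormal Ω z ν) {ξ : Fin N → ℝ}
    (hξ : ∀ a, ∑ i, ξ i * (S.nuS a i : ℝ) = 0) :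
    ∑ i, ξ i * (S.d i * ⟪speciesGradient Ω c i s z, ν⟫_ℝ) = 0 := by
  have hmem : (WithLp.toLp 2 ξ : EuclideanSpace ℝ (Fin N))
      ∈ Submodule.span ℝ (range S.eS) := by
    rw [S.eS_span, Submodule.mem_orthogonal]
    intro u hu
    induction hu using Submodule.span_induction with
    | mem u hu =>
      obtain ⟨a, rfl⟩ := hu
      rw [PiLp.inner_apply]
      simpa [nuS] using hξ a
    | zero => simp
    | add u v _ _ hu hv => rw [inner_add_left, hu, hv, add_zero]
    | smul r u _ hu => rw [inner_smul_left, hu, mul_zero]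
  have key : ∀ x ∈ Submodule.span ℝ (range S.eS),
      ∑ i, x i * (S.d i * ⟪speciesGradient Ω c i s z, ν⟫_ℝ) = 0 := by
    intro x hx
    induction hx using Submodule.span_induction with
    | mem x hx =>
      obtain ⟨k, rfl⟩ := hx
      simp only [inner_speciesGradient]
      exact neg_eq_zero.1 (hc.no_flux s hs z hz ν hν k)
    | zero => simp
    | add x y _ _ hx hy =>
      simp only [PiLp.add_apply, add_mul, Finset.sum_add_distrib, hx, hy, add_zero]
    | smul r x _ hx =>
      simp only [PiLp.smul_apply, smul_eq_mul, mul_assoc, ← Finset.mul_sum, hx, mul_zero]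
  exact key _ hmem

lemma IsPositiveConserved.sum_rate {e : Fin N → ℝ} (he : S.IsPositiveConserved e)
    (v : EuclideanSpace ℝ (Fin N)) : ∑ i, e i * S.rate v i = 0 := by
  simp only [rate, Finset.mul_sum]
  rw [Finset.sum_comm]
  refine Finset.sum_eq_zero fun a _ => ?_
  have : ∀ i, e i * (S.velocity v a * (S.nu a i : ℝ))
      = S.velocity v a * (e i * (S.nu a i : ℝ)) := fun i => by ring
  simp only [this, ← Finset.mul_sum, he.bulk a, mul_zero]

lemma IsClassicalSolution.isConservedDensity (hΩ : IsBoundedC2Domain Ω)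
    (hc : S.IsClassicalSolution Ω T c0 c) {e : Fin N → ℝ} (he : S.IsPositiveConserved e)
    (hτ : τ ∈ timeInterval T) {M : ℝ} (hM : ∀ z ∈ closure Ω, ∑ i, e i * c0 z i ≤ M) :
    IsConservedDensity Ω τ (∑ i, S.d i) M (fun s z => ∑ i, e i * c s z i)
      (fun s z => ∑ i, e i * S.d i * c s z i)
      (fun s z => ∑ i, (e i * S.d i) • speciesGradient Ω c i s z)
      (fun s z => ∑ i, e i * S.d i * speciesLaplacian Ω c i s z) where
  cont := continuousOn_finsetSum _ fun i _ =>
    (hc.regular.hasSpaceDerivs hΩ hτ i).cont.const_smul (e i)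
  deriv z hz s hs := by
    have h1 := HasDerivWithinAt.fun_sum (u := Finset.univ)
      fun i _ => (hc.hasDerivWithinAt hΩ hτ i hz hs).const_mul (e i)
    refine h1.congr_deriv ?_
    simp only [mul_add, Finset.sum_add_distrib, he.sum_rate, add_zero, mul_assoc]
  flux := HasSpaceDerivs.weightedSum hΩ.isOpen (fun i => hc.regular.hasSpaceDerivs hΩ hτ i)
    fun i => e i * S.d i
  noFlux s hs z hz ν hν := by
    rw [sum_inner]
    have h1 := hc.sum_flux_eq_zero (Icc_subset_timeInterval hτ hs) hz hν he.surface
    simpa [real_inner_smul_left, mul_assoc] using h1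
  nonneg s hs z hz := Finset.sum_nonneg fun i _ =>
    mul_nonneg (mul_nonneg (he.pos i).le (S.d_pos i).le)
      (hc.pos s (Icc_subset_timeInterval hτ hs) z hz i).le
  le_mul s hs z hz := by
    rw [Finset.mul_sum]
    refine Finset.sum_le_sum fun i _ => ?_
    have h1 : S.d i ≤ ∑ j, S.d j :=
      Finset.single_le_sum (fun j _ => (S.d_pos j).le) (Finset.mem_univ i)
    have h2 := mul_le_mul_of_nonneg_right h1 (mul_nonneg (he.pos i).le
      (hc.pos s (Icc_subset_timeInterval hτ hs) z hz i).le)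
    linarith
  initial_le z hz := by
    rw [hc.initial z hz]
    exact hM z hz

/-- Surface equilibrium says that the chemical potentials are orthogonal to the surface
stoichiometric vectors. -/
lemma IsClassicalSolution.sum_mu_mul_nuS (hc : S.IsClassicalSolution Ω T c0 c)
    {s : ℝ} (hs : s ∈ timeInterval T) {z : EuclideanSpace ℝ (Fin n)} (hz : z ∈ frontier Ω)
    (a : Fin mS) : ∑ i, S.mu (c s z) i * (S.nuS a i : ℝ) = 0 := by
  have hpos := hc.pos s hs z (frontier_subset_closure hz)
  have h1 := congrArg Real.log (hc.surface_equilibrium s hs z hz a)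
  rw [Real.log_exp, Real.log_prod (fun i _ => (zpow_pos (hpos i) _).ne')] at h1
  simp only [Real.log_zpow] at h1
  simp only [mu, add_mul, Finset.sum_add_distrib]
  simp only [mul_comm] at h1 ⊢
  linarith

/-- Thermodynamic consistency gives `kb c^β = kf c^α exp(ν · μ)`. -/
lemma velocity_mul_affinity {v : EuclideanSpace ℝ (Fin N)} (hv : ∀ i, 0 < v i) (a : Fin m) :
    S.velocity v a * S.affinity v a = -S.reactionDissipation v a := by
  have hexp : Real.exp (S.affinity v a) * (S.kf a * ∏ i, v i ^ S.α a i)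
      = S.kb a * ∏ i, v i ^ S.β a i := by
    have h1 : S.affinity v a = (∑ i, (S.nu a i : ℝ) * S.mu0 i)
        + ∑ i, ((S.β a i : ℝ) * Real.log (v i) - (S.α a i : ℝ) * Real.log (v i)) := by
      simp only [affinity, mu, mul_add, Finset.sum_add_distrib]
      congr 1
      refine Finset.sum_congr rfl fun i _ => ?_
      simp only [nu]
      push_cast
      ring
    have h2 : ∀ k : Fin N → ℕ, Real.exp (∑ i, (k i : ℝ) * Real.log (v i)) = ∏ i, v i ^ k i := by
      intro k
      rw [Real.exp_sum]
      refine Finset.prod_congr rfl fun i _ => ?_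
      rw [Real.exp_nat_mul, Real.exp_log (hv i)]
    have h3 : S.kf a = S.kb a * Real.exp (-∑ i, (S.nu a i : ℝ) * S.mu0 i) := by
      rw [mul_comm]
      exact (div_eq_iff (S.kb_pos a).ne').1 (S.rate_relation a)
    have hα : (∏ i, v i ^ S.α a i) ≠ 0 :=
      (Finset.prod_pos fun i _ => pow_pos (hv i) _).ne'
    rw [h1, Finset.sum_sub_distrib, Real.exp_add, Real.exp_sub, h2, h2, h3, Real.exp_neg]
    field_simp
  rw [velocity, reactionDissipation, ← hexp]
  ring

lemma sum_rate_mul_mu {v : EuclideanSpace ℝ (Fin N)} (hv : ∀ i, 0 < v i) :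
    ∑ i, S.rate v i * S.mu v i = -∑ a, S.reactionDissipation v a := by
  rw [← Finset.sum_neg_distrib]
  simp only [rate, Finset.sum_mul]
  rw [Finset.sum_comm]
  refine Finset.sum_congr rfl fun a _ => ?_
  rw [← velocity_mul_affinity hv, affinity, Finset.mul_sum]
  exact Finset.sum_congr rfl fun i _ => by ring

lemma IsClassicalSolution.continuousOn_species (hΩ : IsBoundedC2Domain Ω)
    (hc : S.IsClassicalSolution Ω T c0 c) (hτ : τ ∈ timeInterval T) (i : Fin N) :
    ContinuousOn (fun p : ℝ × EuclideanSpace ℝ (Fin n) => c p.1 p.2 i) (Icc 0 τ ×ˢ closure Ω) :=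
  (hc.regular.hasSpaceDerivs hΩ hτ i).cont

lemma IsClassicalSolution.species_ne_zero (hc : S.IsClassicalSolution Ω T c0 c)
    (hτ : τ ∈ timeInterval T) (i : Fin N) :
    ∀ p ∈ Icc 0 τ ×ˢ closure Ω, c p.1 p.2 i ≠ 0 := fun p hp =>
  (hc.pos p.1 (Icc_subset_timeInterval hτ hp.1) p.2 hp.2 i).ne'

lemma IsClassicalSolution.continuousOn_mu (hΩ : IsBoundedC2Domain Ω)
    (hc : S.IsClassicalSolution Ω T c0 c) (hτ : τ ∈ timeInterval T) (i : Fin N) :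
    ContinuousOn (fun p : ℝ × EuclideanSpace ℝ (Fin n) => S.mu (c p.1 p.2) i)
      (Icc 0 τ ×ˢ closure Ω) :=
  continuousOn_const.add ((hc.continuousOn_species hΩ hτ i).log (hc.species_ne_zero hτ i))

lemma IsClassicalSolution.continuousOn_entropyDensity (hΩ : IsBoundedC2Domain Ω)
    (hc : S.IsClassicalSolution Ω T c0 c) (hτ : τ ∈ timeInterval T) :
    ContinuousOn (fun p : ℝ × EuclideanSpace ℝ (Fin n) => S.entropyDensity (c p.1 p.2))
      (Icc 0 τ ×ˢ closure Ω) :=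
  continuousOn_finsetSum _ fun i _ => (hc.continuousOn_species hΩ hτ i).mul
    ((hc.continuousOn_mu hΩ hτ i).sub continuousOn_const)

lemma IsClassicalSolution.continuousOn_monomial (hΩ : IsBoundedC2Domain Ω)
    (hc : S.IsClassicalSolution Ω T c0 c) (hτ : τ ∈ timeInterval T) (k : Fin N → ℕ) :
    ContinuousOn (fun p : ℝ × EuclideanSpace ℝ (Fin n) => ∏ i, c p.1 p.2 i ^ k i)
      (Icc 0 τ ×ˢ closure Ω) :=
  continuousOn_finsetProd _ fun i _ => (hc.continuousOn_species hΩ hτ i).pow _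

lemma IsClassicalSolution.continuousOn_rate (hΩ : IsBoundedC2Domain Ω)
    (hc : S.IsClassicalSolution Ω T c0 c) (hτ : τ ∈ timeInterval T) (i : Fin N) :
    ContinuousOn (fun p : ℝ × EuclideanSpace ℝ (Fin n) => S.rate (c p.1 p.2) i)
      (Icc 0 τ ×ˢ closure Ω) :=
  continuousOn_finsetSum _ fun a _ =>
    ((continuousOn_const.mul (hc.continuousOn_monomial hΩ hτ (S.α a))).sub
      (continuousOn_const.mul (hc.continuousOn_monomial hΩ hτ (S.β a)))).mul continuousOn_const

lemma IsClassicalSolution.continuousOn_reactionDissipation (hΩ : IsBoundedC2Domain Ω)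
    (hc : S.IsClassicalSolution Ω T c0 c) (hτ : τ ∈ timeInterval T) (a : Fin m) :
    ContinuousOn (fun p : ℝ × EuclideanSpace ℝ (Fin n) => S.reactionDissipation (c p.1 p.2) a)
      (Icc 0 τ ×ˢ closure Ω) := by
  have h1 : ContinuousOn (fun p : ℝ × EuclideanSpace ℝ (Fin n) => S.affinity (c p.1 p.2) a)
      (Icc 0 τ ×ˢ closure Ω) :=
    continuousOn_finsetSum _ fun i _ => continuousOn_const.mul (hc.continuousOn_mu hΩ hτ i)
  exact (continuousOn_const.mul (hc.continuousOn_monomial hΩ hτ (S.α a))).mul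
    (h1.mul ((h1.rexp).sub continuousOn_const))

/-- The diffusion dissipation density, extended continuously to `closure Ω` by means of the
one-sided gradients. -/
def diffusionDissipationClosure (S : CatalysisSystem N m mS nS)
    (Ω : Set (EuclideanSpace ℝ (Fin n)))
    (c : ℝ → EuclideanSpace ℝ (Fin n) → EuclideanSpace ℝ (Fin N)) (s : ℝ)
    (z : EuclideanSpace ℝ (Fin n)) : ℝ :=
  ∑ i, S.d i * (‖speciesGradient Ω c i s z‖ ^ 2 / c s z i)

lemma diffusionDissipationClosure_eq (hΩ : IsOpen Ω) (s : ℝ) {z : EuclideanSpace ℝ (Fin n)}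
    (hz : z ∈ Ω) :
    S.diffusionDissipationClosure Ω c s z = S.diffusionDissipation (c s) z := by
  simp only [diffusionDissipationClosure, diffusionDissipation,
    speciesGradient_eq_gradient hΩ c _ s hz]

lemma IsClassicalSolution.continuousOn_diffusionDissipationClosure (hΩ : IsBoundedC2Domain Ω)
    (hc : S.IsClassicalSolution Ω T c0 c) (hτ : τ ∈ timeInterval T) :
    ContinuousOn (fun p : ℝ × EuclideanSpace ℝ (Fin n) =>
      S.diffusionDissipationClosure Ω c p.1 p.2) (Icc 0 τ ×ˢ closure Ω) :=
  continuousOn_finsetSum _ fun i _ => continuousOn_const.mul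
    (((hc.regular.hasSpaceDerivs hΩ hτ i).cont_grad.norm.pow 2).div
      (hc.continuousOn_species hΩ hτ i) (hc.species_ne_zero hτ i))

/-- The entropy production at a fixed time. Green's identity is applied to the test functions
`d_i μ_i`; the boundary term vanishes because `μ` is orthogonal to the surface stoichiometric
vectors. -/
lemma IsClassicalSolution.setIntegral_entropy_production (hΩ : IsBoundedC2Domain Ω)
    (hc : S.IsClassicalSolution Ω T c0 c) (hτ : τ ∈ timeInterval T) {s : ℝ} (hs : s ∈ Icc 0 τ) :
    ∫ z in Ω, ∑ i, (S.d i * speciesLaplacian Ω c i s z + S.rate (c s z) i) * S.mu (c s z) i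
      = -(∫ z in Ω, S.diffusionDissipationClosure Ω c s z)
        - ∑ a, ∫ z in Ω, S.reactionDissipation (c s z) a := by
  have hK := hΩ.isCompact_closure
  have hsT := Icc_subset_timeInterval hτ hs
  have hsd := fun i => hc.regular.hasSpaceDerivs hΩ hτ i
  have hpos : ∀ z ∈ closure Ω, ∀ i, 0 < c s z i := hc.pos s hsT
  have hci : ∀ i, ContinuousOn (fun z => c s z i) (closure Ω) := fun i =>
    continuousOn_space_slice (f := fun s z => c s z i) (hsd i).cont hs
  have hmu : ∀ i, ContinuousOn (fun z => S.mu (c s z) i) (closure Ω) := fun i =>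
    continuousOn_space_slice (f := fun s z => S.mu (c s z) i) (hc.continuousOn_mu hΩ hτ i) hs
  have hgreen := green_identity hΩ hsd hs (φ := fun i z => S.d i * S.mu (c s z) i)
    (φ' := fun i z => (S.d i * (c s z i)⁻¹) • speciesGradient Ω c i s z)
    (fun i => continuousOn_const.mul (hmu i))
    (fun i => (continuousOn_const.mul ((hci i).inv₀ fun z hz => (hpos z hz i).ne')).smul
      (continuousOn_space_slice (hsd i).cont_grad hs))
    (fun i z hz => by
      have h1 := ((hsd i).hasFDerivAt s hs z hz).log (hpos z (subset_closure hz) i).ne'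
      refine ((h1.const_add (S.mu0 i)).const_mul (S.d i)).congr_fderiv ?_
      ext v
      simp [mul_assoc])
    (fun z hz ν hν => by
      have h1 := hc.sum_flux_eq_zero hsT hz hν (hc.sum_mu_mul_nuS hsT hz)
      rw [← h1]
      exact Finset.sum_congr rfl fun i _ => by ring)
  have hdiff : IntegrableOn (fun z => S.diffusionDissipationClosure Ω c s z) Ω :=
    integrableOn_space_slice hK (hc.continuousOn_diffusionDissipationClosure hΩ hτ) hs
  have hreac : ∀ a, IntegrableOn (fun z => S.reactionDissipation (c s z) a) Ω := fun a =>
    integrableOn_space_slice (f := fun s z => S.reactionDissipation (c s z) a) hK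
      (hc.continuousOn_reactionDissipation hΩ hτ a) hs
  have hprod : IntegrableOn (fun z =>
      ∑ i, (S.d i * speciesLaplacian Ω c i s z + S.rate (c s z) i) * S.mu (c s z) i) Ω :=
    integrableOn_space_slice (f := fun s z =>
      ∑ i, (S.d i * speciesLaplacian Ω c i s z + S.rate (c s z) i) * S.mu (c s z) i) hK
      (continuousOn_finsetSum _ fun i _ => ((continuousOn_const.mul (hsd i).cont_lap).add
        (hc.continuousOn_rate hΩ hτ i)).mul (hc.continuousOn_mu hΩ hτ i)) hs
  have hpt : ∀ z ∈ Ω, ∑ i, (S.d i * S.mu (c s z) i * speciesLaplacian Ω c i s z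
        + ⟪(S.d i * (c s z i)⁻¹) • speciesGradient Ω c i s z, speciesGradient Ω c i s z⟫_ℝ)
      = (∑ i, (S.d i * speciesLaplacian Ω c i s z + S.rate (c s z) i) * S.mu (c s z) i)
        + (S.diffusionDissipationClosure Ω c s z + ∑ a, S.reactionDissipation (c s z) a) := by
    intro z hz
    have h1 := sum_rate_mul_mu (S := S) (hpos z (subset_closure hz))
    have h2 : ∑ i, (S.d i * speciesLaplacian Ω c i s z + S.rate (c s z) i) * S.mu (c s z) i
        = (∑ i, S.d i * S.mu (c s z) i * speciesLaplacian Ω c i s z)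
          + ∑ i, S.rate (c s z) i * S.mu (c s z) i := by
      rw [← Finset.sum_add_distrib]
      exact Finset.sum_congr rfl fun i _ => by ring
    have h3 : ∑ i, ⟪(S.d i * (c s z i)⁻¹) • speciesGradient Ω c i s z,
        speciesGradient Ω c i s z⟫_ℝ = S.diffusionDissipationClosure Ω c s z := by
      refine Finset.sum_congr rfl fun i _ => ?_
      rw [real_inner_smul_left, real_inner_self_eq_norm_sq]
      ring
    rw [Finset.sum_add_distrib, h3, h2, h1]
    ring
  have hreacS : IntegrableOn (fun z => ∑ a, S.reactionDissipation (c s z) a) Ω :=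
    integrable_finsetSum _ fun a _ => hreac a
  rw [setIntegral_congr_fun hΩ.isOpen.measurableSet hpt, integral_add (g := fun z =>
      S.diffusionDissipationClosure Ω c s z + ∑ a, S.reactionDissipation (c s z) a)
      hprod (hdiff.add hreacS),
    integral_add hdiff hreacS, integral_finsetSum _ fun a _ => hreac a] at hgreen
  linarith

/-- The entropy identity. -/
lemma IsClassicalSolution.entropy_identity (hΩ : IsBoundedC2Domain Ω)
    (hc : S.IsClassicalSolution Ω T c0 c) (hτ : τ ∈ timeInterval T) :
    (∫ z in Ω, S.entropyDensity (c τ z))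
        + (∫ s in (0 : ℝ)..τ, ∫ z in Ω, S.diffusionDissipation (c s) z)
        + (∑ a, ∫ s in (0 : ℝ)..τ, ∫ z in Ω, S.reactionDissipation (c s z) a)
      = ∫ z in Ω, S.entropyDensity (c0 z) := by
  have hK := hΩ.isCompact_closure
  have hsd := fun i => hc.regular.hasSpaceDerivs hΩ hτ i
  have hτ' : τ ∈ Icc 0 τ := ⟨hτ.1, le_rfl⟩
  have hftc := setIntegral_sub_eq_intervalIntegral (f := fun s z => S.entropyDensity (c s z))
    (f' := fun s z =>
      ∑ i, (S.d i * speciesLaplacian Ω c i s z + S.rate (c s z) i) * S.mu (c s z) i)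
    hΩ.isOpen hK (hc.continuousOn_entropyDensity hΩ hτ)
    (continuousOn_finsetSum _ fun i _ => ((continuousOn_const.mul (hsd i).cont_lap).add
        (hc.continuousOn_rate hΩ hτ i)).mul (hc.continuousOn_mu hΩ hτ i))
    (fun z hz s hs => by
      have hpos := hc.pos s (Icc_subset_timeInterval hτ hs) z (subset_closure hz)
      refine HasDerivWithinAt.fun_sum fun i _ => ?_
      have h1 := hc.hasDerivWithinAt hΩ hτ i hz hs
      have h2 := ((h1.log (hpos i).ne').const_add (S.mu0 i)).sub_const 1
      refine (h1.mul h2).congr_deriv ?_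
      have := (hpos i).ne'
      simp only [mu]
      field_simp
      ring) hτ'
  have h0 : ∫ z in Ω, S.entropyDensity (c 0 z) = ∫ z in Ω, S.entropyDensity (c0 z) :=
    setIntegral_congr_fun hΩ.isOpen.measurableSet fun z hz => by
      simp only [hc.initial z (subset_closure hz)]
  have hdiff : ∀ s, ∫ z in Ω, S.diffusionDissipation (c s) z
      = ∫ z in Ω, S.diffusionDissipationClosure Ω c s z := fun s =>
    setIntegral_congr_fun hΩ.isOpen.measurableSet fun z hz =>
      (diffusionDissipationClosure_eq hΩ.isOpen s hz).symm
  have hI1 := intervalIntegrable_setIntegral hK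
    (hc.continuousOn_diffusionDissipationClosure hΩ hτ) hτ'
  have hI2 := fun a => intervalIntegrable_setIntegral
    (f := fun s z => S.reactionDissipation (c s z) a) hK
    (hc.continuousOn_reactionDissipation hΩ hτ a) hτ'
  have hI3 : IntervalIntegrable (fun s => ∑ a, ∫ z in Ω, S.reactionDissipation (c s z) a)
      volume 0 τ := by
    have h1 : (fun s => ∑ a, ∫ z in Ω, S.reactionDissipation (c s z) a)
        = ∑ a, fun s => ∫ z in Ω, S.reactionDissipation (c s z) a := by
      ext s
      simp
    rw [h1]
    exact IntervalIntegrable.sum Finset.univ fun a _ => hI2 a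
  rw [h0, intervalIntegral.integral_congr (g := fun s =>
      -(∫ z in Ω, S.diffusionDissipationClosure Ω c s z)
        - ∑ a, ∫ z in Ω, S.reactionDissipation (c s z) a) (fun s hs => by
        rw [uIcc_of_le hτ.1] at hs
        exact hc.setIntegral_entropy_production hΩ hτ hs),
    intervalIntegral.integral_sub (f := fun s =>
      -(∫ z in Ω, S.diffusionDissipationClosure Ω c s z)) hI1.neg hI3,
    intervalIntegral.integral_neg,
    intervalIntegral.integral_finsetSum fun a _ => hI2 a] at hftc
  simp only [hdiff]
  linarith

end Estimates

end CatalysisSystem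

/-! ### Passage to the half-open time interval -/

section Exhaustion

open Filter Topology

/-- Monotone convergence for set integrals of a nonnegative function along an exhaustion. -/
lemma integrableOn_iUnion_of_setIntegral_le {X : Type*} [MeasurableSpace X] {μ : Measure X}
    {s : ℕ → Set X} (hs : ∀ k, MeasurableSet (s k)) (hmono : Monotone s) {f : X → ℝ}
    (hf : ∀ x ∈ ⋃ k, s k, 0 ≤ f x) (hint : ∀ k, IntegrableOn f (s k) μ) {C : ℝ}
    (hC : ∀ k, ∫ x in s k, f x ∂μ ≤ C) :
    IntegrableOn f (⋃ k, s k) μ ∧ ∫ x in ⋃ k, s k, f x ∂μ ≤ C := by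
  have hnn : 0 ≤ᵐ[μ.restrict (⋃ k, s k)] f :=
    (ae_restrict_iff' (MeasurableSet.iUnion hs)).2 (Eventually.of_forall hf)
  have hlint : ∫⁻ x in ⋃ k, s k, ENNReal.ofReal (f x) ∂μ ≤ ENNReal.ofReal C := by
    rw [setLIntegral_iUnion_of_directed _ (hmono.directed_le)]
    refine iSup_le fun k => ?_
    rw [← ofReal_integral_eq_lintegral_ofReal (hint k)
      ((ae_restrict_iff' (hs k)).2 (Eventually.of_forall fun x hx => hf x (mem_iUnion.2 ⟨k, hx⟩)))]
    exact ENNReal.ofReal_le_ofReal (hC k)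
  have hI : IntegrableOn f (⋃ k, s k) μ :=
    ⟨aestronglyMeasurable_iUnion_iff.2 fun k => (hint k).aestronglyMeasurable,
      (hasFiniteIntegral_iff_ofReal hnn).2 (hlint.trans_lt ENNReal.ofReal_lt_top)⟩
  exact ⟨hI, le_of_tendsto' (tendsto_setIntegral_of_monotone hs hmono hI) hC⟩

/-- Times increasing to `T₀`. -/
def exhaustingTime (T₀ : ℝ) (k : ℕ) : ℝ := T₀ - T₀ / (k + 1)

lemma exhaustingTime_mem {T₀ : ℝ} (hT₀ : 0 < T₀) (k : ℕ) : exhaustingTime T₀ k ∈ Ico 0 T₀ := by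
  refine ⟨sub_nonneg.2 (div_le_self hT₀.le ?_), sub_lt_self _ (by positivity)⟩
  linarith [Nat.cast_nonneg (α := ℝ) k]

lemma monotone_exhaustingTime {T₀ : ℝ} (hT₀ : 0 < T₀) : Monotone (exhaustingTime T₀) := by
  intro j k hjk
  have : (j : ℝ) ≤ k := by exact_mod_cast hjk
  unfold exhaustingTime
  gcongr

lemma iUnion_Icc_exhaustingTime {T₀ : ℝ} (hT₀ : 0 < T₀) :
    ⋃ k, Icc 0 (exhaustingTime T₀ k) = Ico 0 T₀ := by
  ext t
  simp only [mem_iUnion]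
  constructor
  · rintro ⟨k, hk⟩
    exact ⟨hk.1, hk.2.trans_lt (exhaustingTime_mem hT₀ k).2⟩
  · rintro ⟨h0, hT⟩
    obtain ⟨k, hk⟩ := exists_nat_gt (T₀ / (T₀ - t))
    refine ⟨k, h0, ?_⟩
    have hpos : 0 < T₀ - t := sub_pos.2 hT
    rw [div_lt_iff₀ hpos] at hk
    have h1 : T₀ / (k + 1) ≤ T₀ - t := by
      rw [div_le_iff₀ (by positivity)]
      nlinarith
    unfold exhaustingTime
    linarith

end Exhaustion

namespace CatalysisSystem

section APriori

open Filter Topology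

variable {n N m mS nS : ℕ} {Ω : Set (EuclideanSpace ℝ (Fin n))} {S : CatalysisSystem N m mS nS}
  {T : EReal} {τ T₀ : ℝ} {c0 : EuclideanSpace ℝ (Fin n) → EuclideanSpace ℝ (Fin N)}
  {c : ℝ → EuclideanSpace ℝ (Fin n) → EuclideanSpace ℝ (Fin N)} {e : Fin N → ℝ}

lemma IsPositiveConserved.exists_lower_bound (he : S.IsPositiveConserved e) :
    ∃ δ > 0, ∀ i, δ ≤ e i ∧ δ ≤ e i * S.d i := by
  have h := fun i => lt_min (he.pos i) (mul_pos (he.pos i) (S.d_pos i))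
  rcases isEmpty_or_nonempty (Fin N) with hN | hN
  · exact ⟨1, one_pos, fun i => hN.elim i⟩
  · obtain ⟨j, hj⟩ := Finite.exists_min fun i => min (e i) (e i * S.d i)
    exact ⟨_, h j, fun i => ⟨(hj i).trans (min_le_left _ _), (hj i).trans (min_le_right _ _)⟩⟩

lemma IsClassicalSolution.integrableOn_species (hΩ : IsBoundedC2Domain Ω)
    (hc : S.IsClassicalSolution Ω T c0 c) (hτ : τ ∈ timeInterval T) (i : Fin N) :
    IntegrableOn (fun z => c τ z i) Ω :=
  integrableOn_space_slice (f := fun s z => c s z i) hΩ.isCompact_closure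
    (hc.continuousOn_species hΩ hτ i) ⟨hτ.1, le_rfl⟩

lemma IsClassicalSolution.setIntegral_sum_abs_le (hΩ : IsBoundedC2Domain Ω)
    (hc : S.IsClassicalSolution Ω T c0 c) (he : S.IsPositiveConserved e)
    (hτ : τ ∈ timeInterval T) {M : ℝ} (hM : ∀ z ∈ closure Ω, ∑ i, e i * c0 z i ≤ M) :
    ∫ z in Ω, ∑ i, |c τ z i| ≤ ((⨆ i, e i) / (⨅ i, e i)) * ∫ z in Ω, ∑ i, |c 0 z i| := by
  rcases isEmpty_or_nonempty (Fin N) with hN | hN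
  · simp
  have h0 : (0 : ℝ) ∈ timeInterval T := Icc_subset_timeInterval hτ ⟨le_rfl, hτ.1⟩
  have hinf : 0 < ⨅ i, e i := by
    obtain ⟨j, hj⟩ := exists_eq_ciInf_of_finite (f := e)
    rw [← hj]
    exact he.pos j
  have hint : ∀ s ∈ timeInterval T, ∀ κ : Fin N → ℝ,
      IntegrableOn (fun z => ∑ i, κ i * c s z i) Ω := fun s hs κ =>
    integrable_finsetSum _ fun i _ => (hc.integrableOn_species hΩ hs i).const_mul (κ i)
  have habs : ∀ s ∈ timeInterval T, ∀ z ∈ Ω, ∑ i, |c s z i| = ∑ i, c s z i :=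
    fun s hs z hz => Finset.sum_congr rfl fun i _ =>
      abs_of_pos (hc.pos s hs z (subset_closure hz) i)
  have hint1 : ∀ s ∈ timeInterval T, IntegrableOn (fun z => ∑ i, c s z i) Ω := fun s hs => by
    simpa using hint s hs fun _ => 1
  have hmass := (hc.isConservedDensity hΩ he hτ hM).setIntegral_eq hΩ ⟨hτ.1, le_rfl⟩
  rw [setIntegral_congr_fun hΩ.isOpen.measurableSet (habs τ hτ),
    setIntegral_congr_fun hΩ.isOpen.measurableSet (habs 0 h0), div_mul_eq_mul_div,
    le_div_iff₀ hinf, mul_comm]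
  calc (⨅ i, e i) * ∫ z in Ω, ∑ i, c τ z i
      = ∫ z in Ω, (⨅ i, e i) * ∑ i, c τ z i := (integral_const_mul _ _).symm
    _ ≤ ∫ z in Ω, ∑ i, e i * c τ z i := by
        refine setIntegral_mono_on ((hint1 τ hτ).const_mul _) (hint τ hτ e)
          hΩ.isOpen.measurableSet fun z hz => ?_
        rw [Finset.mul_sum]
        exact Finset.sum_le_sum fun i _ => mul_le_mul_of_nonneg_right
          (ciInf_le (finite_range e).bddBelow i) (hc.pos τ hτ z (subset_closure hz) i).le
    _ = ∫ z in Ω, ∑ i, e i * c 0 z i := hmass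
    _ ≤ ∫ z in Ω, (⨆ i, e i) * ∑ i, c 0 z i := by
        refine setIntegral_mono_on (hint 0 h0 e) ((hint1 0 h0).const_mul _)
          hΩ.isOpen.measurableSet fun z hz => ?_
        rw [Finset.mul_sum]
        exact Finset.sum_le_sum fun i _ => mul_le_mul_of_nonneg_right
          (le_ciSup (finite_range e).bddAbove i) (hc.pos 0 h0 z (subset_closure hz) i).le
    _ = (⨆ i, e i) * ∫ z in Ω, ∑ i, c 0 z i := integral_const_mul _ _

lemma sum_d_nonneg (S : CatalysisSystem N m mS nS) : 0 ≤ ∑ i, S.d i :=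
  Finset.sum_nonneg fun i _ => (S.d_pos i).le

lemma IsClassicalSolution.time_integral_le (hΩ : IsBoundedC2Domain Ω)
    (hc : S.IsClassicalSolution Ω T c0 c) (he : S.IsPositiveConserved e) (hT₀ : 0 < T₀)
    (hT : (T₀ : EReal) ≤ T) {M : ℝ} (hM0 : 0 ≤ M) (hM : ∀ z ∈ closure Ω, ∑ i, e i * c0 z i ≤ M)
    {δ : ℝ} (hδ : 0 < δ) (hδe : ∀ i, δ ≤ e i ∧ δ ≤ e i * S.d i)
    {z : EuclideanSpace ℝ (Fin n)} (hz : z ∈ closure Ω) :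
    (∀ i, IntegrableOn (fun t => c t z i) (Ico 0 T₀)) ∧
      ∫ t in Ico 0 T₀, ∑ i, |c t z i| ≤ (∑ i, S.d i) * M * T₀ / δ := by
  have hmem : ∀ t ∈ Ico 0 T₀, t ∈ timeInterval T := fun t ht =>
    ⟨ht.1, (EReal.coe_lt_coe_iff.2 ht.2).trans_le hT⟩
  have hslice : ∀ k i, ContinuousOn (fun t => c t z i) (Icc 0 (exhaustingTime T₀ k)) := fun k i =>
    continuousOn_time_slice (f := fun t z => c t z i)
      (hc.continuousOn_species hΩ (hmem _ (exhaustingTime_mem hT₀ k)) i) hz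
  have hsub : ∀ k, Icc 0 (exhaustingTime T₀ k) ⊆ Ico 0 T₀ := fun k t ht =>
    ⟨ht.1, ht.2.trans_lt (exhaustingTime_mem hT₀ k).2⟩
  have hcont : ∀ k, ContinuousOn (fun t => ∑ i, |c t z i|) (Icc 0 (exhaustingTime T₀ k)) :=
    fun k => continuousOn_finsetSum _ fun i _ => (hslice k i).abs
  have hbound : ∀ k, ∫ t in Icc 0 (exhaustingTime T₀ k), ∑ i, |c t z i|
      ≤ (∑ i, S.d i) * M * T₀ / δ := by
    intro k
    have hk := exhaustingTime_mem hT₀ k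
    have hcd := hc.isConservedDensity hΩ he (hmem _ hk) hM
    have h1 := hcd.time_primitive_le hΩ S.sum_d_nonneg ⟨hk.1, le_rfl⟩ hz
    rw [intervalIntegral.integral_of_le hk.1, ← integral_Icc_eq_integral_Ioc] at h1
    rw [le_div_iff₀ hδ, mul_comm, ← integral_const_mul]
    calc ∫ t in Icc 0 (exhaustingTime T₀ k), δ * ∑ i, |c t z i|
        ≤ ∫ t in Icc 0 (exhaustingTime T₀ k), ∑ i, e i * S.d i * c t z i := by
          refine setIntegral_mono_on ((hcont k).const_smul δ).integrableOn_Icc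
            (continuousOn_finsetSum _ fun i _ => (hslice k i).const_smul
              (e i * S.d i)).integrableOn_Icc measurableSet_Icc fun t ht => ?_
          rw [Finset.mul_sum]
          refine Finset.sum_le_sum fun i _ => ?_
          have hp := hc.pos t (hmem t (hsub k ht)) z hz i
          rw [abs_of_pos hp]
          exact mul_le_mul_of_nonneg_right (hδe i).2 hp.le
      _ ≤ (∑ i, S.d i) * M * exhaustingTime T₀ k := h1
      _ ≤ (∑ i, S.d i) * M * T₀ :=
          mul_le_mul_of_nonneg_left hk.2.le (mul_nonneg S.sum_d_nonneg hM0)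
  have hex := integrableOn_iUnion_of_setIntegral_le (μ := volume)
    (s := fun k => Icc 0 (exhaustingTime T₀ k)) (fun k => measurableSet_Icc)
    (fun j k hjk => Icc_subset_Icc_right (monotone_exhaustingTime hT₀ hjk))
    (f := fun t => ∑ i, |c t z i|) (fun t _ => Finset.sum_nonneg fun i _ => abs_nonneg _)
    (fun k => (hcont k).integrableOn_Icc) hbound
  rw [iUnion_Icc_exhaustingTime hT₀] at hex
  refine ⟨fun i => hex.1.mono' ?_ (Eventually.of_forall fun t => ?_), hex.2⟩
  · rw [← iUnion_Icc_exhaustingTime hT₀]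
    exact aestronglyMeasurable_iUnion_iff.2 fun k =>
      (hslice k i).aestronglyMeasurable measurableSet_Icc
  · rw [Real.norm_eq_abs]
    exact Finset.single_le_sum (f := fun i => |c t z i|) (fun j _ => abs_nonneg _)
      (Finset.mem_univ i)

lemma norm_sq_le_mul {δ : ℝ} (hδ : 0 < δ) (hδe : ∀ i, δ ≤ e i ∧ δ ≤ e i * S.d i)
    {v : EuclideanSpace ℝ (Fin N)} (hv : ∀ i, 0 < v i) :
    δ ^ 2 * ‖v‖ ^ 2 ≤ (∑ i, e i * v i) * ∑ i, e i * S.d i * v i := by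
  have h1 : ‖v‖ ^ 2 ≤ (∑ i, v i) ^ 2 := by
    rw [EuclideanSpace.real_norm_sq_eq]
    exact Finset.sum_sq_le_sq_sum_of_nonneg fun i _ => (hv i).le
  have h2 : δ * ∑ i, v i ≤ ∑ i, e i * v i := by
    rw [Finset.mul_sum]
    exact Finset.sum_le_sum fun i _ => mul_le_mul_of_nonneg_right (hδe i).1 (hv i).le
  have h3 : δ * ∑ i, v i ≤ ∑ i, e i * S.d i * v i := by
    rw [Finset.mul_sum]
    exact Finset.sum_le_sum fun i _ => mul_le_mul_of_nonneg_right (hδe i).2 (hv i).le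
  have h4 : 0 ≤ δ * ∑ i, v i := mul_nonneg hδ.le (Finset.sum_nonneg fun i _ => (hv i).le)
  calc δ ^ 2 * ‖v‖ ^ 2 ≤ δ ^ 2 * (∑ i, v i) ^ 2 := by gcongr
    _ = (δ * ∑ i, v i) * (δ * ∑ i, v i) := by ring
    _ ≤ _ := mul_le_mul h2 h3 h4 (h4.trans h2)

lemma IsClassicalSolution.memLp_two (hΩ : IsBoundedC2Domain Ω)
    (hc : S.IsClassicalSolution Ω T c0 c) (he : S.IsPositiveConserved e) (hT₀ : 0 < T₀)
    (hT : (T₀ : EReal) ≤ T) {M : ℝ} (hM0 : 0 ≤ M) (hM : ∀ z ∈ closure Ω, ∑ i, e i * c0 z i ≤ M)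
    {δ : ℝ} (hδ : 0 < δ) (hδe : ∀ i, δ ≤ e i ∧ δ ≤ e i * S.d i) :
    MemLp (fun p : ℝ × EuclideanSpace ℝ (Fin n) => c p.1 p.2) 2
        (volume.restrict (Ico 0 T₀ ×ˢ Ω)) ∧
      eLpNorm (fun p : ℝ × EuclideanSpace ℝ (Fin n) => c p.1 p.2) 2
        (volume.restrict (Ico 0 T₀ ×ˢ Ω)) ≤ ENNReal.ofReal
          (√(M * ((∑ i, S.d i) * M * T₀ * volume.real Ω) / δ ^ 2)) := by
  have hmem : ∀ t ∈ Ico 0 T₀, t ∈ timeInterval T := fun t ht =>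
    ⟨ht.1, (EReal.coe_lt_coe_iff.2 ht.2).trans_le hT⟩
  have hcont : ∀ k, ContinuousOn (fun p : ℝ × EuclideanSpace ℝ (Fin n) => c p.1 p.2)
      (Icc 0 (exhaustingTime T₀ k) ×ˢ closure Ω) := fun k =>
    hc.regular.continuousOn.mono (prod_mono
      (Icc_subset_timeInterval (hmem _ (exhaustingTime_mem hT₀ k))) subset_rfl)
  have hms : ∀ k, MeasurableSet (Icc 0 (exhaustingTime T₀ k) ×ˢ Ω) := fun k =>
    measurableSet_Icc.prod hΩ.isOpen.measurableSet
  have hunion : ⋃ k, Icc 0 (exhaustingTime T₀ k) ×ˢ Ω = Ico 0 T₀ ×ˢ Ω := by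
    rw [← iUnion_prod_const, iUnion_Icc_exhaustingTime hT₀]
  have hsq : ∀ k, IntegrableOn (fun p : ℝ × EuclideanSpace ℝ (Fin n) => ‖c p.1 p.2‖ ^ 2)
      (Icc 0 (exhaustingTime T₀ k) ×ˢ Ω) := fun k =>
    (((hcont k).norm.pow 2).integrableOn_compact
      (isCompact_Icc.prod hΩ.isCompact_closure)).mono_set (prod_mono subset_rfl subset_closure)
  have hbound : ∀ k, ∫ p in Icc 0 (exhaustingTime T₀ k) ×ˢ Ω, ‖c p.1 p.2‖ ^ 2
      ≤ M * ((∑ i, S.d i) * M * T₀ * volume.real Ω) / δ ^ 2 := by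
    intro k
    have hk := exhaustingTime_mem hT₀ k
    have hcd := hc.isConservedDensity hΩ he (hmem _ hk) hM
    have hkk : exhaustingTime T₀ k ∈ Icc 0 (exhaustingTime T₀ k) := ⟨hk.1, le_rfl⟩
    have h1 := hcd.intervalIntegral_mul_le hΩ S.sum_d_nonneg hM0 hkk
    have hwa : ContinuousOn (fun p : ℝ × EuclideanSpace ℝ (Fin n) =>
        (∑ i, e i * c p.1 p.2 i) * ∑ i, e i * S.d i * c p.1 p.2 i)
        (Icc 0 (exhaustingTime T₀ k) ×ˢ closure Ω) := hcd.cont.mul hcd.flux.cont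
    have hwaI : IntegrableOn (fun p : ℝ × EuclideanSpace ℝ (Fin n) =>
        (∑ i, e i * c p.1 p.2 i) * ∑ i, e i * S.d i * c p.1 p.2 i)
        (Icc 0 (exhaustingTime T₀ k) ×ˢ Ω) :=
      (hwa.integrableOn_compact (isCompact_Icc.prod hΩ.isCompact_closure)).mono_set
        (prod_mono subset_rfl subset_closure)
    rw [intervalIntegral.integral_of_le hk.1, ← integral_Icc_eq_integral_Ioc,
      ← setIntegral_prod (μ := volume) (ν := volume)
        (fun p : ℝ × EuclideanSpace ℝ (Fin n) =>
          (∑ i, e i * c p.1 p.2 i) * ∑ i, e i * S.d i * c p.1 p.2 i)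
        (by rw [← Measure.volume_eq_prod]; exact hwaI), ← Measure.volume_eq_prod] at h1
    rw [le_div_iff₀ (by positivity), mul_comm, ← integral_const_mul]
    calc ∫ p in Icc 0 (exhaustingTime T₀ k) ×ˢ Ω, δ ^ 2 * ‖c p.1 p.2‖ ^ 2
        ≤ ∫ p in Icc 0 (exhaustingTime T₀ k) ×ˢ Ω,
            (∑ i, e i * c p.1 p.2 i) * ∑ i, e i * S.d i * c p.1 p.2 i :=
          setIntegral_mono_on ((hsq k).const_mul _) hwaI (hms k) fun p hp =>
            norm_sq_le_mul hδ hδe fun i => hc.pos p.1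
              (Icc_subset_timeInterval (hmem _ hk) hp.1) p.2 (subset_closure hp.2) i
      _ ≤ M * ((∑ i, S.d i) * M * exhaustingTime T₀ k * volume.real Ω) := h1
      _ ≤ M * ((∑ i, S.d i) * M * T₀ * volume.real Ω) := by
          have h2 := mul_le_mul_of_nonneg_left hk.2.le (mul_nonneg S.sum_d_nonneg hM0)
          gcongr
  have hex := integrableOn_iUnion_of_setIntegral_le (μ := volume) hms
    (fun j k hjk => prod_mono (Icc_subset_Icc_right (monotone_exhaustingTime hT₀ hjk)) subset_rfl)
    (f := fun p : ℝ × EuclideanSpace ℝ (Fin n) => ‖c p.1 p.2‖ ^ 2)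
    (fun p _ => by positivity) hsq hbound
  rw [hunion] at hex
  have haes : AEStronglyMeasurable (fun p : ℝ × EuclideanSpace ℝ (Fin n) => c p.1 p.2)
      (volume.restrict (Ico 0 T₀ ×ˢ Ω)) := by
    rw [← hunion]
    exact aestronglyMeasurable_iUnion_iff.2 fun k =>
      ((hcont k).mono (prod_mono subset_rfl subset_closure)).aestronglyMeasurable (hms k)
  have hL : MemLp (fun p : ℝ × EuclideanSpace ℝ (Fin n) => c p.1 p.2) 2
      (volume.restrict (Ico 0 T₀ ×ˢ Ω)) := (memLp_two_iff_integrable_sq_norm haes).2 hex.1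
  refine ⟨hL, ?_⟩
  rw [hL.eLpNorm_eq_integral_rpow_norm two_ne_zero ENNReal.ofNat_ne_top]
  refine ENNReal.ofReal_le_ofReal ?_
  simp only [ENNReal.toReal_ofNat, Real.rpow_ofNat]
  rw [← one_div, ← Real.sqrt_eq_rpow]
  exact Real.sqrt_le_sqrt hex.2

end APriori

end CatalysisSystem

end

theorem mainTheorem5 {n N m mS nS : ℕ} (Ω : Set (EuclideanSpace ℝ (Fin n)))
    (hΩ : IsBoundedC2Domain Ω) (S : CatalysisSystem N m mS nS)
    (e : Fin N → ℝ) (he : S.IsPositiveConserved e)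
    (T₀ : ℝ) (hT₀ : 0 < T₀) (c0 : EuclideanSpace ℝ (Fin n) → EuclideanSpace ℝ (Fin N)) :
    ∃ C : ℝ, 0 < C ∧
      ∀ (Tmax : EReal) (c : ℝ → EuclideanSpace ℝ (Fin n) → EuclideanSpace ℝ (Fin N)),
        (T₀ : EReal) ≤ Tmax → S.IsClassicalSolution Ω Tmax c0 c →
        -- sup in time of the spatial `L₁`-norm
        ((∀ i, IntegrableOn (fun z => c0 z i) Ω) ∧
          ∀ t ∈ Ico 0 T₀, (∀ i, IntegrableOn (fun z => c t z i) Ω) ∧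
            ∫ z in Ω, ∑ i, |c t z i| ≤
              ((⨆ i, e i) / (⨅ i, e i)) * ∫ z in Ω, ∑ i, |c0 z i|) ∧
        -- sup in space of the temporal `L₁`-norm
        (∀ z ∈ closure Ω, (∀ i, IntegrableOn (fun t => c t z i) (Ico 0 T₀)) ∧
          ∫ t in Ico 0 T₀, ∑ i, |c t z i| ≤ C) ∧
        -- space-time `L₂`-norm
        (MemLp (fun p : ℝ × EuclideanSpace ℝ (Fin n) => c p.1 p.2) 2
            (volume.restrict (Ico 0 T₀ ×ˢ Ω)) ∧
          eLpNorm (fun p : ℝ × EuclideanSpace ℝ (Fin n) => c p.1 p.2) 2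
            (volume.restrict (Ico 0 T₀ ×ˢ Ω)) ≤ ENNReal.ofReal C) ∧
        -- entropy identity
        (IntegrableOn (fun z => S.entropyDensity (c0 z)) Ω ∧
          ∀ t ∈ Ico 0 T₀,
            IntegrableOn (fun z => S.entropyDensity (c t z)) Ω ∧
            IntegrableOn (fun p : ℝ × EuclideanSpace ℝ (Fin n) =>
              S.diffusionDissipation (c p.1) p.2) (Ioc 0 t ×ˢ Ω) ∧
            (∀ a, IntegrableOn (fun p : ℝ × EuclideanSpace ℝ (Fin n) =>
              S.reactionDissipation (c p.1 p.2) a) (Ioc 0 t ×ˢ Ω)) ∧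
            (∫ z in Ω, S.entropyDensity (c t z))
                + (∫ s in (0 : ℝ)..t, ∫ z in Ω, S.diffusionDissipation (c s) z)
                + (∑ a, ∫ s in (0 : ℝ)..t, ∫ z in Ω, S.reactionDissipation (c s z) a)
              = ∫ z in Ω, S.entropyDensity (c0 z)) := by
  -- `M` is fixed before the solution; if the initial data are unbounded any value will do, since
  -- then there is no solution
  have hMex : ∃ M : ℝ, 0 ≤ M ∧ ((∃ M', ∀ z ∈ closure Ω, ∑ i, e i * c0 z i ≤ M') →
      ∀ z ∈ closure Ω, ∑ i, e i * c0 z i ≤ M) := by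
    by_cases h : ∃ M', ∀ z ∈ closure Ω, ∑ i, e i * c0 z i ≤ M'
    · obtain ⟨M', hM'⟩ := h
      exact ⟨max M' 0, le_max_right _ _, fun _ z hz => (hM' z hz).trans (le_max_left _ _)⟩
    · exact ⟨0, le_rfl, fun h' => absurd h' h⟩
  obtain ⟨M, hM0, hM'⟩ := hMex
  obtain ⟨δ, hδ, hδe⟩ := he.exists_lower_bound
  set C₁ : ℝ := (∑ i, S.d i) * M * T₀ / δ with hC₁
  set C₂ : ℝ := √(M * ((∑ i, S.d i) * M * T₀ * volume.real Ω) / δ ^ 2) with hC₂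
  have hC₁0 : 0 ≤ C₁ :=
    div_nonneg (mul_nonneg (mul_nonneg S.sum_d_nonneg hM0) hT₀.le) hδ.le
  have hC₂0 : 0 ≤ C₂ := Real.sqrt_nonneg _
  refine ⟨C₁ + C₂ + 1, by positivity, fun Tmax c hT hc => ?_⟩
  have hmem : ∀ t ∈ Ico 0 T₀, t ∈ timeInterval Tmax := fun t ht =>
    ⟨ht.1, (EReal.coe_lt_coe_iff.2 ht.2).trans_le hT⟩
  have h0 : (0 : ℝ) ∈ timeInterval Tmax := hmem 0 ⟨le_rfl, hT₀⟩
  have hinit : ∀ f : EuclideanSpace ℝ (Fin N) → ℝ, EqOn (fun z => f (c 0 z))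
      (fun z => f (c0 z)) Ω := fun f z hz => by simp only [hc.initial z (subset_closure hz)]
  -- the initial data are bounded because they are the trace of a continuous function
  have hM : ∀ z ∈ closure Ω, ∑ i, e i * c0 z i ≤ M := by
    refine hM' ?_
    have h1 : ContinuousOn (fun z => ∑ i, e i * c 0 z i) (closure Ω) :=
      continuousOn_space_slice (f := fun s z => ∑ i, e i * c s z i) (τ := 0)
        (continuousOn_finsetSum _ fun i _ =>
          continuousOn_const.mul (hc.continuousOn_species hΩ h0 i)) ⟨le_rfl, le_rfl⟩
    obtain ⟨M', hM'⟩ := hΩ.isCompact_closure.exists_bound_of_continuousOn h1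
    refine ⟨M', fun z hz => ?_⟩
    rw [← hc.initial z hz]
    exact (le_abs_self _).trans (hM' z hz)
  have hK := hΩ.isCompact_closure
  refine ⟨⟨fun i => ?_, fun t ht => ⟨hc.integrableOn_species hΩ (hmem t ht), ?_⟩⟩,
    fun z hz => ?_, ?_, ?_, fun t ht => ⟨?_, ?_, fun a => ?_, ?_⟩⟩
  · exact (hc.integrableOn_species hΩ h0 i).congr_fun (hinit (fun v => v i))
      hΩ.isOpen.measurableSet
  · rw [← setIntegral_congr_fun hΩ.isOpen.measurableSet (hinit (fun v => ∑ i, |v i|))]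
    exact hc.setIntegral_sum_abs_le hΩ he (hmem t ht) hM
  · obtain ⟨h1, h2⟩ := hc.time_integral_le hΩ he hT₀ hT hM0 hM hδ hδe hz
    exact ⟨h1, h2.trans (by linarith)⟩
  · obtain ⟨h1, h2⟩ := hc.memLp_two hΩ he hT₀ hT hM0 hM hδ hδe
    exact ⟨h1, h2.trans (ENNReal.ofReal_le_ofReal (by linarith))⟩
  · exact (integrableOn_space_slice (f := fun s z => S.entropyDensity (c s z)) hK
      (hc.continuousOn_entropyDensity hΩ h0) ⟨le_rfl, le_rfl⟩).congr_fun
      (hinit S.entropyDensity) hΩ.isOpen.measurableSet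
  · exact integrableOn_space_slice (f := fun s z => S.entropyDensity (c s z)) hK
      (hc.continuousOn_entropyDensity hΩ (hmem t ht)) ⟨ht.1, le_rfl⟩
  · exact (integrableOn_cylinder hK
      (hc.continuousOn_diffusionDissipationClosure hΩ (hmem t ht)) ⟨ht.1, le_rfl⟩).congr_fun
      (fun p hp => CatalysisSystem.diffusionDissipationClosure_eq hΩ.isOpen p.1 hp.2)
      (measurableSet_Ioc.prod hΩ.isOpen.measurableSet)
  · exact integrableOn_cylinder (f := fun s z => S.reactionDissipation (c s z) a) hK
      (hc.continuousOn_reactionDissipation hΩ (hmem t ht) a) ⟨ht.1, le_rfl⟩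
  · exact hc.entropy_identity hΩ (hmem t ht)
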